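/- **Setting.** Let $A\in\mathbb{R}^{m\times n}$, $b\in\mathbb{R}^m$, $c\in\mathbb{R}^n$, $V_p=\{x\in\mathbb{R}^n: Ax=b\}$, let $q$ be the element of $V_p$ of least Euclidean norm, and let $V_d=c+(\ker A)^{\perp}$. Consider $$\text{(P)}\ \min\{c^\top x: x\in\mathcal F_p\},\quad \mathcal F_p=V_p\cap\mathbb{R}^n_+,\qquad \text{(D)}\ \max\{-q^\top s: s\in\mathcal F_d\},\quad \mathcal F_d=V_d\cap\mathbb{R}^n_+,$$ with optimal solution sets $\mathcal X^\star,\mathcal S^\star$. Assume that (P) has an optimal solution, that $c\in\ker A$, and that (P) and (D) both have non-optimal feasible solutions. Norms and distances are Euclidean. The *LP sharpness* of (P) is $\mu_p=\inf_{x\in\mathcal F_p\setminus\mathcal X^\star}\mathrm{Dist}(x,V_p\cap H^\star)/\mathrm{Dist}(x,\mathcal X^\star)$, where $H^\star=\{x: c^\top x=f^\star\}$ and $f^\star$ is the optimal value. The *Limiting Error Ratio* of (P) is $\theta_p^\star=\lim_{\epsilon\downarrow0}\sup\{\theta(x): x\in V_p,\ \mathrm{Dist}(x,\mathcal X^\star)\le\epsilon\}$,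 where $\theta(x)=1$ for $x\in\mathcal F_p$ and $\theta(x)=\mathrm{Dist}(x,\mathcal F_p)/\mathrm{Dist}(x,\mathbb{R}^n_+)$ for $x\in V_p\setminus\mathcal F_p$. The quantities $\mu_d,\theta_d^\star$ are defined in the same way for (D). Let $\lambda_{\max},\lambda_{\min}$ be the largest and smallest nonzero singular values of $A$, $\kappa=\lambda_{\max}/\lambda_{\min}$, and $\mathcal E_d(x,s)=\max\{\mathrm{Dist}(x,\mathcal X^\star),\mathrm{Dist}(s,\mathcal S^\star)\}$. **Restarted PDHG.** Let $L(x,y)=c^\top x+b^\top y-y^\top Ax$. For step-sizes $\tau,\sigma>0$, one PDHG iteration maps $(x,y)$ to $(x^+,y^+)$ with $$x^+=\big(x-\tau(c-A^\top y)\big)_+,\qquad y^+=y+\sigma\big(b-A(2x^+-x)\big).$$ Let $\|(x,y)\|_M^2=\|x\|^2/\tau+2y^\top Ax+\|y\|^2/\sigma$, and for $z=(x,y)$, $r>0$, let $$\rho(r;z)=\tfrac1r\sup\{L(x,\hat y)-L(\hat x,y): \hat x\ge0,\ \|(\hat x,\hat y)-z\|_M\le r\},\qquad \rho(0;z)=0.$$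 Start from $z^{0,0}=(0,0)$. In the outer iteration $N=0,1,2,\dots$ run PDHG from $z^{N,0}$; let $z^{N,k}$ be its iterates and $\bar z^{N,k}=\frac1k\sum_{i=1}^kz^{N,i}$. Stop this outer iteration at the first $k\ge1$ satisfying the $\beta$-restart condition, and set $z^{N+1,0}=\bar z^{N,k}$. The condition is $k=1$ if $N=0$, and for $N\ge1$ it is $$\rho(\|\bar z^{N,k}-z^{N,0}\|_M;\bar z^{N,k})\le\beta\,\rho(\|z^{N,0}-z^{N-1,0}\|_M;z^{N,0}).$$ Take $\beta=1/e$. For $\varepsilon>0$ let $T$ be the total number of PDHG iterations run in order to obtain a $z^{N,0}=(x,y)$ with $\mathcal E_d(x,c-A^\top y)\le\varepsilon$. **Statement.** Suppose that (P) and (D) each have a unique optimal solution. Then $\mu_p,\mu_d>0$. Set $$\mathcal L_1=8.5\,\kappa(\sqrt n+1)\Big(\frac1{\mu_p}+\frac1{\mu_d}\Big)\Big(\frac1{\mu_p}\cdot\frac{\mathrm{Dist}(0,\mathcal S^\star)}{\mathrm{Dist}(0,V_d)}+\frac1{\mu_d}\cdot\frac{\mathrm{Dist}(0,\mathcal X^\star)}{\mathrm{Dist}(0,V_p)}\Big),$$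 $$\mathcal L_2=16\,\kappa(\sqrt n+1)\Big(\frac1{\mu_p^2}\cdot\frac{\mathrm{Dist}(0,\mathcal S^\star)}{\mathrm{Dist}(0,V_d)}+\frac1{\mu_d^2}\cdot\frac{\mathrm{Dist}(0,\mathcal X^\star)}{\mathrm{Dist}(0,V_p)}\Big).$$ 1. These constants dominate the ones that involve the Limiting Error Ratios: $$8.5\,\kappa\Big(\frac1{\mu_p}+\frac1{\mu_d}\Big)\Big(\theta_p^\star+\theta_d^\star+\frac{\mathrm{Dist}(0,\mathcal X^\star)}{\mathrm{Dist}(0,V_p)}+\frac{\mathrm{Dist}(c,\mathcal S^\star)}{\mathrm{Dist}(0,V_d)}\Big)\le\mathcal L_1,$$ $$16\,\kappa\Big(\frac{\theta_p^\star}{\mu_p}+\frac{\theta_d^\star}{\mu_d}+\frac{\mathrm{Dist}(c,\mathcal S^\star)}{\mu_p\,\mathrm{Dist}(0,V_d)}+\frac{\mathrm{Dist}(0,\mathcal X^\star)}{\mu_d\,\mathrm{Dist}(0,V_p)}\Big)\le\mathcal L_2.$$ 2. (Standard step-sizes) If $\tau=\frac{\|q\|}{2\kappa\|c\|}$ and $\sigma=\frac{\|c\|}{2\|q\|\lambda_{\max}\lambda_{\min}}$,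 then for every $0<\varepsilon\le\mathcal E_d(0,c)$ the number $T$ is finite (the outer iterations needed all terminate) and $$T\le 9e\,\mathcal L_1\ln\Big(16e\,\mathcal L_1\frac{\mathcal E_d(0,c)}{\varepsilon}\Big(1+\kappa\frac{\|c\|}{\|q\|}\Big)\Big(1+\frac{\|q\|}{\|c\|}\Big)\Big)+1.$$ 3. (Optimized step-sizes) If $\tau=\frac{\mu_d\|q\|}{2\kappa\mu_p\|c\|}$ and $\sigma=\frac{\mu_p\|c\|}{2\mu_d\|q\|\lambda_{\max}\lambda_{\min}}$, then for every $0<\varepsilon\le\mathcal E_d(0,c)$ the number $T$ is finite and $$T\le 9e\,\mathcal L_2\ln\Big(16e\,\mathcal L_2\frac{\mathcal E_d(0,c)}{\varepsilon}\Big(1+\kappa\frac{\mu_p\|c\|}{\mu_d\|q\|}\Big)\Big(1+\frac{\mu_d\|q\|}{\mu_p\|c\|}\Big)\Big)+1.$$ -/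

import Mathlib

open scoped RealInnerProductSpace

namespace RPDHG

noncomputable section

/-- Euclidean space `ℝⁿ`. -/
abbrev E (n : ℕ) := EuclideanSpace ℝ (Fin n)

/-! ### Linear programs `min gᵀ x` over `x ∈ V`, `x ≥ 0`, and their condition measures -/

/-- The nonnegative orthant. -/
def orthant (n : ℕ) : Set (E n) := {x | ∀ i, 0 ≤ x i}

/-- Feasible set `V ∩ ℝⁿ₊`. -/
def feasible {n : ℕ} (V : Set (E n)) : Set (E n) := V ∩ orthant n

/-- Optimal solutions of `min gᵀ x` subject to `x ∈ V`, `x ≥ 0`. -/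
def optimal {n : ℕ} (g : E n) (V : Set (E n)) : Set (E n) :=
  {x | x ∈ feasible V ∧ ∀ x' ∈ feasible V, ⟪g, x⟫ ≤ ⟪g, x'⟫}

/-- Optimal value of `min gᵀ x` subject to `x ∈ V`, `x ≥ 0`. -/
def optValue {n : ℕ} (g : E n) (V : Set (E n)) : ℝ :=
  sInf ((fun x : E n => ⟪g, x⟫) '' feasible V)

/-- The hyperplane of the optimal objective value. -/
def optHyperplane {n : ℕ} (g : E n) (V : Set (E n)) : Set (E n) :=
  {x | ⟪g, x⟫ = optValue g V}

/-- LP sharpness. -/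
def sharpness {n : ℕ} (g : E n) (V : Set (E n)) : ℝ :=
  sInf ((fun x : E n =>
    Metric.infDist x (V ∩ optHyperplane g V) / Metric.infDist x (optimal g V)) ''
      (feasible V \ optimal g V))

open Classical in
/-- The error ratio of the feasible set at a point of `V`. -/
def errorRatio {n : ℕ} (V : Set (E n)) (x : E n) : ℝ :=
  if x ∈ feasible V then 1
  else Metric.infDist x (feasible V) / Metric.infDist x (orthant n)

/-- Limiting Error Ratio: the limit, as `ε` decreases to `0`, of the largest error ratio over the
points of `V` at distance at most `ε` from the optimal set. -/
def limitingErrorRatio {n : ℕ} (g : E n) (V : Set (E n)) : ℝ :=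
  Filter.limUnder (nhdsWithin (0 : ℝ) (Set.Ioi 0)) fun ε : ℝ =>
    sSup (errorRatio V '' {x | x ∈ V ∧ Metric.infDist x (optimal g V) ≤ ε})

/-! ### The primal-dual pair -/

/-- `x ↦ A x` on Euclidean spaces. -/
def app {m n : ℕ} (A : Matrix (Fin m) (Fin n) ℝ) : E n →ₗ[ℝ] E m := A.toEuclideanLin

/-- `y ↦ Aᵀ y` on Euclidean spaces. -/
def appT {m n : ℕ} (A : Matrix (Fin m) (Fin n) ℝ) : E m →ₗ[ℝ] E n :=
  A.transpose.toEuclideanLin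

/-- The primal affine subspace `V_p = {x : A x = b}`. -/
def Vp {m n : ℕ} (A : Matrix (Fin m) (Fin n) ℝ) (b : E m) : Set (E n) := {x | app A x = b}

/-- The linear subspace associated with `V_p`. -/
def vecVp {m n : ℕ} (A : Matrix (Fin m) (Fin n) ℝ) : Submodule ℝ (E n) := LinearMap.ker (app A)

/-- The dual affine subspace `V_d`, the translate by `c` of the orthogonal complement of the
linear subspace associated with `V_p`. -/
def Vd {m n : ℕ} (A : Matrix (Fin m) (Fin n) ℝ) (c : E n) : Set (E n) :=
  {s | s - c ∈ (vecVp A)ᗮ}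

/-- `q` is the element of `V_p` of least norm. -/
def IsLeastNorm {m n : ℕ} (A : Matrix (Fin m) (Fin n) ℝ) (b : E m) (q : E n) : Prop :=
  q ∈ Vp A b ∧ ∀ q' ∈ Vp A b, ‖q‖ ≤ ‖q'‖

/-- Primal optimal solutions `X⋆`. -/
def Xopt {m n : ℕ} (A : Matrix (Fin m) (Fin n) ℝ) (b : E m) (c : E n) : Set (E n) :=
  optimal c (Vp A b)

/-- Dual optimal solutions `S⋆`: the maximizers of `-qᵀ s` over `s ∈ V_d`, `s ≥ 0`, that is,
the minimizers of `qᵀ s`. -/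
def Sopt {m n : ℕ} (A : Matrix (Fin m) (Fin n) ℝ) (c q : E n) : Set (E n) :=
  optimal q (Vd A c)

/-- The standing assumption: the primal problem has an optimal solution, the objective vector lies
in the linear subspace associated with `V_p`, and both problems have non-optimal feasible
solutions. -/
def StandingAssumption {m n : ℕ} (A : Matrix (Fin m) (Fin n) ℝ) (b : E m) (c q : E n) : Prop :=
  (Xopt A b c).Nonempty ∧ c ∈ vecVp A ∧
    (feasible (Vp A b) \ Xopt A b c).Nonempty ∧ (feasible (Vd A c) \ Sopt A c q).Nonempty

/-- Primal LP sharpness. -/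
def muP {m n : ℕ} (A : Matrix (Fin m) (Fin n) ℝ) (b : E m) (c : E n) : ℝ :=
  sharpness c (Vp A b)

/-- Dual LP sharpness. -/
def muD {m n : ℕ} (A : Matrix (Fin m) (Fin n) ℝ) (c q : E n) : ℝ :=
  sharpness q (Vd A c)

/-- Primal Limiting Error Ratio. -/
def thetaP {m n : ℕ} (A : Matrix (Fin m) (Fin n) ℝ) (b : E m) (c : E n) : ℝ :=
  limitingErrorRatio c (Vp A b)

/-- Dual Limiting Error Ratio. -/
def thetaD {m n : ℕ} (A : Matrix (Fin m) (Fin n) ℝ) (c q : E n) : ℝ :=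
  limitingErrorRatio q (Vd A c)

/-- The set of nonzero singular values of `A`. -/
def posSingularValues {m n : ℕ} (A : Matrix (Fin m) (Fin n) ℝ) : Set ℝ :=
  {t | t ≠ 0 ∧ ∃ i : ℕ, (app A).singularValues i = t}

/-- Largest nonzero singular value. -/
def lamMax {m n : ℕ} (A : Matrix (Fin m) (Fin n) ℝ) : ℝ := sSup (posSingularValues A)

/-- Smallest nonzero singular value. -/
def lamMin {m n : ℕ} (A : Matrix (Fin m) (Fin n) ℝ) : ℝ := sInf (posSingularValues A)

/-- Condition number `κ`. -/
def kappa {m n : ℕ} (A : Matrix (Fin m) (Fin n) ℝ) : ℝ := lamMax A / lamMin A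

/-- The distance-to-optima error of a pair `(x, s)`. -/
def errD {m n : ℕ} (A : Matrix (Fin m) (Fin n) ℝ) (b : E m) (c q x s : E n) : ℝ :=
  max (Metric.infDist x (Xopt A b c)) (Metric.infDist s (Sopt A c q))

/-! ### Restarted PDHG -/

/-- Projection onto the nonnegative orthant. -/
def posPart {n : ℕ} (x : E n) : E n := WithLp.toLp 2 fun i => max (x i) 0

/-- One iteration of PDHG for the saddle point problem
`min_{x ≥ 0} max_y cᵀ x + bᵀ y - yᵀ A x`. -/
def pdhgStep {m n : ℕ} (A : Matrix (Fin m) (Fin n) ℝ) (b : E m) (c : E n) (τ σ : ℝ)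
    (z : E n × E m) : E n × E m :=
  (posPart (z.1 - τ • (c - appT A z.2)),
    z.2 + σ • (b - app A ((2 : ℝ) • posPart (z.1 - τ • (c - appT A z.2)) - z.1)))

/-- The average of the first `k` PDHG iterates computed from `z` (`z` itself excluded). -/
def pdhgAverage {m n : ℕ} (A : Matrix (Fin m) (Fin n) ℝ) (b : E m) (c : E n) (τ σ : ℝ)
    (z : E n × E m) (k : ℕ) : E n × E m :=
  (k : ℝ)⁻¹ • ∑ i ∈ Finset.range k, (pdhgStep A b c τ σ)^[i + 1] z

/-- The Lagrangian `cᵀ x + bᵀ y - yᵀ A x`. -/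
def lagrangian {m n : ℕ} (A : Matrix (Fin m) (Fin n) ℝ) (b : E m) (c : E n)
    (x : E n) (y : E m) : ℝ :=
  ⟪c, x⟫ + ⟪b, y⟫ - ⟪app A x, y⟫

/-- The norm `‖(x, y)‖_M = (‖x‖²/τ + 2 yᵀ A x + ‖y‖²/σ)^{1/2}`, in which a PDHG iteration is a
proximal point step. -/
def normM {m n : ℕ} (A : Matrix (Fin m) (Fin n) ℝ) (τ σ : ℝ) (z : E n × E m) : ℝ :=
  Real.sqrt (‖z.1‖ ^ 2 / τ + 2 * ⟪app A z.1, z.2⟫ + ‖z.2‖ ^ 2 / σ)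

/-- The normalized duality gap
`ρ(r; z) = (1/r) max {L(x, y') - L(x', y) : x' ≥ 0, ‖(x', y') - (x, y)‖_M ≤ r}`.
(For `r = 0` this is `0`; it is used with `r = 0` only at saddle points, where all `ρ(r; z)`
vanish.) -/
def normalizedGap {m n : ℕ} (A : Matrix (Fin m) (Fin n) ℝ) (b : E m) (c : E n) (τ σ : ℝ)
    (r : ℝ) (z : E n × E m) : ℝ :=
  (1 / r) * sSup ((fun z' : E n × E m =>
    lagrangian A b c z.1 z'.2 - lagrangian A b c z'.1 z.2) ''
      {z' | z'.1 ∈ orthant n ∧ normM A τ σ (z' - z) ≤ r})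

/-- The `β`-restart condition for the average `k` steps after the `N`-th restart point `z`, where
`zprev` is the restart point before `z`: the first outer iteration restarts at `k = 1`, and later
ones when the normalized duality gap has decreased by the factor `β`. -/
def RestartCondition {m n : ℕ} (A : Matrix (Fin m) (Fin n) ℝ) (b : E m) (c : E n) (τ σ β : ℝ)
    (N : ℕ) (zprev z : E n × E m) (k : ℕ) : Prop :=
  (N = 0 ∧ k = 1) ∨
  (N ≠ 0 ∧
    normalizedGap A b c τ σ (normM A τ σ (pdhgAverage A b c τ σ z k - z))
        (pdhgAverage A b c τ σ z k)
      ≤ β * normalizedGap A b c τ σ (normM A τ σ (z - zprev)) z)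

/-- `Reaches A b c τ σ β N T zprev z`: restarted PDHG with the `β`-restart condition, started from
`(0, 0)`, has after exactly `N` outer iterations and `T` PDHG iterations in total the restart
point `z = z^{N,0}`, the preceding restart point being `zprev` (for `N = 0` there is none, and
`zprev` is a dummy). Each outer iteration ends at the first `k ≥ 1` for which the restart
condition holds, and the next one starts from the average of its iterates. -/
inductive Reaches {m n : ℕ} (A : Matrix (Fin m) (Fin n) ℝ) (b : E m) (c : E n) (τ σ β : ℝ) :
    ℕ → ℕ → E n × E m → E n × E m → Prop
  | start : Reaches A b c τ σ β 0 0 0 0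
  | restart (N T k : ℕ) (zprev z : E n × E m) :
      Reaches A b c τ σ β N T zprev z →
      IsLeast {j : ℕ | 1 ≤ j ∧ RestartCondition A b c τ σ β N zprev z j} k →
      Reaches A b c τ σ β (N + 1) (T + k) z (pdhgAverage A b c τ σ z k)

/-- `T` is the total number of PDHG iterations that restarted PDHG runs in order to obtain a
restart point `(x, y)` whose pair `(x, s)`, `s = c - Aᵀ y`, has distance-to-optima error at
most `ε`. -/
def IsIterationCount {m n : ℕ} (A : Matrix (Fin m) (Fin n) ℝ) (b : E m) (c q : E n)
    (τ σ β ε : ℝ) (T : ℕ) : Prop :=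
  IsLeast {T' : ℕ | ∃ (N : ℕ) (zprev z : E n × E m), Reaches A b c τ σ β N T' zprev z ∧
    errD A b c q z.1 (c - appT A z.2) ≤ ε} T

/-- The form of the complexity bound:
`9 e L ln(16 e L (E₀/ε) (1 + κ ω) (1 + 1/ω)) + 1`. -/
def iterationBound (L κ ω E₀ ε : ℝ) : ℝ :=
  9 * Real.exp 1 * L *
    Real.log (16 * Real.exp 1 * L * (E₀ / ε) * (1 + κ * ω) * (1 + 1 / ω)) + 1

/-- Relative distance to the primal optima, `Dist(0, X⋆) / Dist(0, V_p)`. -/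
def relDistP {m n : ℕ} (A : Matrix (Fin m) (Fin n) ℝ) (b : E m) (c : E n) : ℝ :=
  Metric.infDist 0 (Xopt A b c) / Metric.infDist 0 (Vp A b)

/-- Relative distance of `v` to the dual optima, `Dist(v, S⋆) / Dist(0, V_d)`. -/
def relDistD {m n : ℕ} (A : Matrix (Fin m) (Fin n) ℝ) (c q v : E n) : ℝ :=
  Metric.infDist v (Sopt A c q) / Metric.infDist 0 (Vd A c)

/-- The constant for the standard step-sizes that involves the Limiting Error Ratios. -/
def standardL {m n : ℕ} (A : Matrix (Fin m) (Fin n) ℝ) (b : E m) (c q : E n) : ℝ :=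
  8.5 * kappa A * (1 / muP A b c + 1 / muD A c q) *
    (thetaP A b c + thetaD A c q + relDistP A b c + relDistD A c q c)

/-- The constant for the optimized step-sizes that involves the Limiting Error Ratios. -/
def optimizedL {m n : ℕ} (A : Matrix (Fin m) (Fin n) ℝ) (b : E m) (c q : E n) : ℝ :=
  16 * kappa A *
    (thetaP A b c / muP A b c + thetaD A c q / muD A c q +
      relDistD A c q c / muP A b c + relDistP A b c / muD A c q)

/-- The simplified constant for the standard step-sizes. -/
def standardL' {m n : ℕ} (A : Matrix (Fin m) (Fin n) ℝ) (b : E m) (c q : E n) : ℝ :=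
  8.5 * kappa A * (Real.sqrt n + 1) * (1 / muP A b c + 1 / muD A c q) *
    (1 / muP A b c * relDistD A c q 0 + 1 / muD A c q * relDistP A b c)

/-- The simplified constant for the optimized step-sizes. -/
def optimizedL' {m n : ℕ} (A : Matrix (Fin m) (Fin n) ℝ) (b : E m) (c q : E n) : ℝ :=
  16 * kappa A * (Real.sqrt n + 1) *
    (1 / muP A b c ^ 2 * relDistD A c q 0 + 1 / muD A c q ^ 2 * relDistP A b c)

end

end RPDHG

namespace RPDHG

/-! Geometry. Uniqueness of the primal optimum `xs` gives linear growth of the objective on the cone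
of feasible directions, so the objective is interior to the dual cone and some dual feasible point
is strictly complementary to `xs` (`exists_strictly_complementary`). By dual uniqueness that point
is `ss`. Uniqueness also makes both solutions nondegenerate: no nonzero vector of `(ker A)ᗮ`
vanishes on the support of `xs`, and none of `ker A` on the support of `ss`. Hence the coordinates
on the zero set of the optimum can be prescribed freely within the direction space, and every
direction is a difference of two feasible ones carrying its positive and negative parts there
(`exists_split`). Sharpness applied to both pieces yields two facts: `μ ‖g‖ ‖v‖ ≤ ∑ s₀ i |v i|` on
the whole direction space (`mul_norm_le_sum_abs`), and a Limiting Error Ratio of at most `‖s₀‖ / (μ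
‖g‖)` (`limitingErrorRatio_le`). The second gives the comparison of constants; of `√n + 1` only the
bound `2 ≤ √n + 1` is ever used.

Algorithm. A PDHG iteration is a proximal point step in the norm `normM`. So distances to a saddle
point do not increase, and the normalized gap of the average of `k` steps is at most `4 dist / k`
(`normalizedGap_average_le_dist`). Conversely, a small normalized gap bounds infeasibility and
duality gap, and the growth inequalities turn these into `dist ≤ K ρ` with `K = errorConst`
(`SharpPair.normM_sub_le`). Together, `⌈4 e K⌉` steps always divide the gap by `e`, so every outer
iteration ends within that many steps and the error decays geometrically. It remains to check `K ≤
𝓛₁` or `K ≤ 𝓛₂` for the two step-size choices. The Limiting Error Ratios play no role in the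
complexity bounds. -/

theorem inner_eq_sum {n : ℕ} (x y : E n) : ⟪x, y⟫ = ∑ i, x i * y i := by
  simp [PiLp.inner_apply, mul_comm]

/-! ### Geometry of a linear program with a unique optimal solution -/

/-- `V` is an affine subspace with direction `W`. -/
def IsTranslate {n : ℕ} (V : Set (E n)) (W : Submodule ℝ (E n)) : Prop :=
  ∀ x ∈ V, ∀ y, y ∈ V ↔ y - x ∈ W

/-- Directions `v` of `W` that point into the orthant at `x`. -/
def feasibleCone {n : ℕ} (W : Submodule ℝ (E n)) (x : E n) : Set (E n) :=
  {v | v ∈ W ∧ ∀ i, x i = 0 → 0 ≤ v i}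

theorem exists_pos_add_mem_orthant {n : ℕ} {x : E n} (hx : x ∈ orthant n) :
    ∃ δ > 0, ∀ v : E n, ‖v‖ ≤ δ → (∀ i, x i = 0 → 0 ≤ v i) → x + v ∈ orthant n := by
  have h : ∃ δ > 0, ∀ i, x i ≠ 0 → δ ≤ x i := by
    have : ∀ᶠ δ in nhdsWithin (0 : ℝ) (Set.Ioi 0), ∀ i, x i ≠ 0 → δ ≤ x i := by
      rw [Filter.eventually_all]
      intro i
      by_cases hi : x i = 0
      · simp [hi]
      · have h0 : 0 < x i := lt_of_le_of_ne (hx i) (Ne.symm hi)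
        filter_upwards [Ioo_mem_nhdsGT h0] with δ hδ _ using hδ.2.le
    obtain ⟨δ, h1, h2⟩ := (this.and self_mem_nhdsWithin).exists
    exact ⟨δ, h2, h1⟩
  obtain ⟨δ, hδ, h⟩ := h
  refine ⟨δ, hδ, fun v hv hv0 i => ?_⟩
  rw [PiLp.add_apply]
  by_cases hi : x i = 0
  · rw [hi, zero_add]; exact hv0 i hi
  · have h1 := (PiLp.norm_apply_le v i).trans hv
    rw [Real.norm_eq_abs] at h1
    linarith [h i hi, neg_abs_le (v i)]

section Unique

variable {n : ℕ} {W : Submodule ℝ (E n)} {V : Set (E n)} {g x₀ : E n}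

/-- A short step from `x₀` along `v` stays feasible; if `⟪g, v⟫ ≤ 0` it would end at a second
optimum. -/
theorem inner_pos_of_mem_feasibleCone (hV : IsTranslate V W) (hx : x₀ ∈ optimal g V)
    (hu : ∀ x ∈ optimal g V, x = x₀) {v : E n} (hv : v ∈ feasibleCone W x₀) (hv0 : v ≠ 0) :
    0 < ⟪g, v⟫ := by
  obtain ⟨δ, hδ, h⟩ := exists_pos_add_mem_orthant hx.1.2
  have hn : 0 < ‖v‖ := norm_pos_iff.2 hv0
  set t := δ / ‖v‖ with ht
  have ht0 : 0 < t := by positivity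
  have hf : x₀ + t • v ∈ feasible V := by
    refine ⟨(hV x₀ hx.1.1 _).2 (by simpa using W.smul_mem t hv.1), h _ ?_ ?_⟩
    · rw [norm_smul, Real.norm_of_nonneg ht0.le, ht, div_mul_cancel₀ _ hn.ne']
    · intro i hi
      simpa using mul_nonneg ht0.le (hv.2 i hi)
  by_contra hle
  have hopt : x₀ + t • v ∈ optimal g V := by
    refine ⟨hf, fun x' hx' => le_trans ?_ (hx.2 x' hx')⟩
    rw [inner_add_right, real_inner_smul_right]
    nlinarith
  have := hu _ hopt
  simp [ht0.ne', hv0] at this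

theorem isClosed_feasibleCone : IsClosed (feasibleCone W x₀) := by
  have h1 : IsClosed (W : Set (E n)) := W.closed_of_finiteDimensional
  have h2 : IsClosed {v : E n | ∀ i, x₀ i = 0 → 0 ≤ v i} := by
    simp only [Set.ofPred_forall]
    exact isClosed_iInter fun i => isClosed_iInter fun _ =>
      isClosed_le continuous_const (by fun_prop)
  exact h1.inter h2

/-- The cone is closed, so its unit vectors form a compact set on which the positive function `⟪g,
·⟫` has a positive minimum; homogeneity does the rest. -/
theorem exists_pos_mul_norm_le_inner (hV : IsTranslate V W) (hx : x₀ ∈ optimal g V)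
    (hu : ∀ x ∈ optimal g V, x = x₀) :
    ∃ m > 0, ∀ v ∈ feasibleCone W x₀, m * ‖v‖ ≤ ⟪g, v⟫ := by
  have hc : IsCompact (feasibleCone W x₀ ∩ Metric.sphere 0 1) :=
    (isCompact_sphere (0 : E n) 1).inter_left isClosed_feasibleCone
  have hm : ∃ m > 0, ∀ v ∈ feasibleCone W x₀ ∩ Metric.sphere 0 1, m ≤ ⟪g, v⟫ := by
    rcases (feasibleCone W x₀ ∩ Metric.sphere (0 : E n) 1).eq_empty_or_nonempty with he | hne
    · exact ⟨1, one_pos, fun v hv => by simp [he] at hv⟩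
    · obtain ⟨v, hv, hmin⟩ := hc.exists_isMinOn hne
        (f := fun v : E n => ⟪g, v⟫) (by fun_prop)
      refine ⟨⟪g, v⟫, inner_pos_of_mem_feasibleCone hV hx hu hv.1 ?_, fun w hw => hmin hw⟩
      rintro rfl
      simpa using hv.2
  obtain ⟨m, hm0, hm⟩ := hm
  refine ⟨m, hm0, fun v hv => ?_⟩
  by_cases hv0 : v = 0
  · simp [hv0]
  have hn : 0 < ‖v‖ := norm_pos_iff.2 hv0
  have := hm (‖v‖⁻¹ • v) ⟨⟨W.smul_mem _ hv.1, fun i hi => by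
    simpa using mul_nonneg (inv_nonneg.2 hn.le) (hv.2 i hi)⟩, by simp [norm_smul, hn.ne']⟩
  rw [real_inner_smul_right] at this
  calc m * ‖v‖ ≤ (‖v‖⁻¹ * ⟪g, v⟫) * ‖v‖ := by gcongr
    _ = ⟪g, v⟫ := by field_simp

/-- The cone dual to `feasibleCone W x₀`, before closure. -/
def dualCone {n : ℕ} (W : Submodule ℝ (E n)) (x : E n) : Set (E n) :=
  {u | ∃ p : E n, u - p ∈ Wᗮ ∧ (∀ i, 0 ≤ p i) ∧ ∀ i, x i ≠ 0 → p i = 0}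

theorem convex_dualCone : Convex ℝ (dualCone W x₀) := by
  rintro u ⟨p, hp, hp0, hp1⟩ u' ⟨p', hp', hp0', hp1'⟩ a b ha hb -
  refine ⟨a • p + b • p', ?_, fun i => ?_, fun i hi => ?_⟩
  · have := Wᗮ.add_mem (Wᗮ.smul_mem a hp) (Wᗮ.smul_mem b hp')
    convert this using 1
    module
  · simpa using add_nonneg (mul_nonneg ha (hp0 i)) (mul_nonneg hb (hp0' i))
  · simp [hp1 i hi, hp1' i hi]

/-- Farkas' lemma up to closure, by separation: the negative of a separating vector is a feasible
direction violating `h`. Working with the closure avoids proving that a finitely generated cone is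
closed. -/
theorem mem_closure_dualCone {u : E n} (h : ∀ v ∈ feasibleCone W x₀, 0 ≤ ⟪u, v⟫) :
    u ∈ closure (dualCone W x₀) := by
  by_contra hu
  obtain ⟨f, r, hf, hr⟩ :=
    geometric_hahn_banach_closed_point convex_dualCone.closure isClosed_closure hu
  set y := (InnerProductSpace.toDual ℝ (E n)).symm f with hy
  have hfy : ∀ z, f z = ⟪y, z⟫ := fun z => by simp [hy]
  have hr0 : 0 < r := by
    have := hf 0 (subset_closure ⟨0, by simp, by simp, by simp⟩)
    simpa using this
  -- `dualCone` is stable under nonnegative scaling, so a functional bounded above on it cannot be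
  -- positive there.
  have hle : ∀ a ∈ dualCone W x₀, f a ≤ 0 := by
    rintro a ⟨p, hp, hp0, hp1⟩
    by_contra hpos
    push Not at hpos
    have := hf ((r / f a) • a) (subset_closure ⟨(r / f a) • p, ?_, fun i => ?_, fun i hi => ?_⟩)
    · rw [map_smul, smul_eq_mul, div_mul_cancel₀ _ hpos.ne'] at this
      exact lt_irrefl _ this
    · rw [← smul_sub]; exact Wᗮ.smul_mem _ hp
    · simpa using mul_nonneg (div_nonneg hr0.le hpos.le) (hp0 i)
    · simp [hp1 i hi]
  have hyW : y ∈ W := by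
    rw [← W.orthogonal_orthogonal, Submodule.mem_orthogonal]
    intro w hw
    have h1 := hle w ⟨0, by simpa using hw, by simp, by simp⟩
    have h2 := hle (-w) ⟨0, by simpa using hw, by simp, by simp⟩
    rw [map_neg] at h2
    rw [real_inner_comm, ← hfy]
    linarith
  have hcone : -y ∈ feasibleCone W x₀ := by
    refine ⟨W.neg_mem hyW, fun i hi => ?_⟩
    have := hle (EuclideanSpace.single i 1) ⟨EuclideanSpace.single i 1, by simp, fun j => ?_,
      fun j hj => ?_⟩
    · rw [hfy, EuclideanSpace.inner_single_right] at this
      simpa using this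
    · by_cases hij : j = i <;> simp [hij]
    · have : j ≠ i := fun e => hj (e ▸ hi)
      simp [this]
  have := h _ hcone
  rw [inner_neg_right, real_inner_comm, ← hfy] at this
  linarith

/-- Strict complementarity: a linear program with a unique optimal solution has a dual feasible
point that is positive exactly where the optimal solution vanishes. -/
theorem exists_strictly_complementary (hV : IsTranslate V W) (hx : x₀ ∈ optimal g V)
    (hu : ∀ x ∈ optimal g V, x = x₀) :
    ∃ s : E n, s - g ∈ Wᗮ ∧ (∀ i, x₀ i = 0 → 0 < s i) ∧ ∀ i, x₀ i ≠ 0 → s i = 0 := by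
  obtain ⟨m, hm, hmg⟩ := exists_pos_mul_norm_le_inner hV hx hu
  -- By the growth constant `m`, every vector within `m` of `g` is still nonnegative on the feasible
  -- cone.
  have hball : Metric.ball g m ⊆ closure (dualCone W x₀) := by
    intro u hu
    refine mem_closure_dualCone fun v hv => ?_
    have h1 : ⟪g - u, v⟫ ≤ ‖g - u‖ * ‖v‖ := real_inner_le_norm _ _
    rw [inner_sub_left] at h1
    have h2 : ‖g - u‖ ≤ m := by
      rw [Metric.mem_ball, dist_comm, dist_eq_norm] at hu
      exact hu.le
    nlinarith [hmg v hv, mul_le_mul_of_nonneg_right h2 (norm_nonneg v)]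
  -- Removing the closure: affine subspaces are closed, so the cone itself spans the space and has
  -- nonempty interior, and a convex set with interior has the same interior as its closure.
  have hspan : affineSpan ℝ (dualCone W x₀) = ⊤ := by
    have hc : IsClosed (affineSpan ℝ (dualCone W x₀) : Set (E n)) :=
      AffineSubspace.closed_of_finiteDimensional _
    have h1 : Metric.ball g m ⊆ affineSpan ℝ (dualCone W x₀) :=
      hball.trans (closure_minimal (subset_affineSpan ℝ _) hc)
    have h2 : affineSpan ℝ (Metric.ball g m) = ⊤ :=
      Metric.isOpen_ball.affineSpan_eq_top ⟨g, Metric.mem_ball_self hm⟩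
    rw [eq_top_iff, ← h2]
    exact affineSpan_le.2 h1
  have hint := convex_dualCone.interior_nonempty_iff_affineSpan_eq_top.2 hspan
  have hball' : Metric.ball g m ⊆ dualCone W x₀ := by
    refine Set.Subset.trans ?_ interior_subset
    rw [← convex_dualCone.interior_closure_eq_interior_of_nonempty_interior hint]
    exact interior_maximal hball Metric.isOpen_ball
  -- Room for strictness: `g` is pushed inward by `t • e`, with `t ‖e‖ < m`, and adding `t • e` back
  -- to the multiplier makes it positive on all zeros of `x₀`.
  set e : E n := WithLp.toLp 2 fun i => if x₀ i = 0 then 1 else 0 with he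
  set t := m / (‖e‖ + 1) / 2 with ht
  have ht0 : 0 < t := by positivity
  have hmem : g - t • e ∈ Metric.ball g m := by
    rw [Metric.mem_ball, dist_eq_norm, sub_sub_cancel_left, norm_neg, norm_smul,
      Real.norm_of_nonneg ht0.le]
    have : t * (‖e‖ + 1) = m / 2 := by rw [ht]; field_simp
    nlinarith
  obtain ⟨p, hp, hp0, hp1⟩ := hball' hmem
  refine ⟨p + t • e, ?_, fun i hi => ?_, fun i hi => ?_⟩
  · have := Wᗮ.neg_mem hp
    convert this using 1
    abel
  · have : (p + t • e) i = p i + t := by simp [he, hi]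
    rw [this]
    linarith [hp0 i]
  · simp [he, hi, hp1 i hi]

theorem optimal_eq_singleton (hx : x₀ ∈ optimal g V) (hu : ∀ x ∈ optimal g V, x = x₀) :
    optimal g V = {x₀} :=
  Set.eq_singleton_iff_unique_mem.2 ⟨hx, hu⟩

theorem optValue_eq (hx : x₀ ∈ optimal g V) : optValue g V = ⟪g, x₀⟫ := by
  refine IsLeast.csInf_eq ⟨⟨x₀, hx.1, rfl⟩, ?_⟩
  rintro _ ⟨x, hxF, rfl⟩
  exact hx.2 x hxF

/-- Since `g ∈ W`, projecting onto the hyperplane along `g` does not leave `V`, so the distance is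
that to the hyperplane alone. -/
theorem infDist_inter_optHyperplane (hV : IsTranslate V W) (hg : g ∈ W) (hg0 : g ≠ 0)
    (hx : x₀ ∈ optimal g V) {x : E n} (hxF : x ∈ feasible V) :
    Metric.infDist x (V ∩ optHyperplane g V) = ⟪g, x - x₀⟫ / ‖g‖ := by
  have hn : 0 < ‖g‖ := norm_pos_iff.2 hg0
  have h0 : 0 ≤ ⟪g, x - x₀⟫ := by
    rw [inner_sub_right]; linarith [hx.2 x hxF]
  have hne : (V ∩ optHyperplane g V).Nonempty := ⟨x₀, hx.1.1, (optValue_eq hx).symm⟩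
  apply le_antisymm
  · have hmem : x - (⟪g, x - x₀⟫ / ‖g‖ ^ 2) • g ∈ V ∩ optHyperplane g V := by
      refine ⟨(hV x hxF.1 _).2 ?_, ?_⟩
      · rw [sub_sub_cancel_left]
        exact W.neg_mem (W.smul_mem _ hg)
      · change ⟪g, _⟫ = _
        rw [optValue_eq hx, inner_sub_right, real_inner_smul_right, real_inner_self_eq_norm_sq,
          div_mul_cancel₀ _ (by positivity), inner_sub_right]
        ring
    refine (Metric.infDist_le_dist_of_mem hmem).trans_eq ?_
    rw [dist_eq_norm, sub_sub_cancel, norm_smul, Real.norm_of_nonneg (by positivity)]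
    field_simp
  · refine (Metric.le_infDist hne).2 fun y hy => ?_
    have hyv : ⟪g, y⟫ = ⟪g, x₀⟫ := by rw [← optValue_eq hx]; exact hy.2
    rw [div_le_iff₀ hn, dist_eq_norm]
    have h1 := real_inner_le_norm g (x - y)
    rw [inner_sub_right] at h1 ⊢
    linarith

theorem feasible_sub_mem_feasibleCone (hV : IsTranslate V W) (hx : x₀ ∈ optimal g V) {x : E n}
    (hxF : x ∈ feasible V) : x - x₀ ∈ feasibleCone W x₀ :=
  ⟨(hV x₀ hx.1.1 x).1 hxF.1, fun i hi => by simpa [hi] using hxF.2 i⟩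

/-- The sharpness quotient is constant along rays from the unique optimum, so its bound on the
feasible set near `x₀` extends to the whole cone of feasible directions. -/
theorem sharpness_mul_norm_le (hV : IsTranslate V W) (hg : g ∈ W) (hg0 : g ≠ 0)
    (hx : x₀ ∈ optimal g V) (hu : ∀ x ∈ optimal g V, x = x₀) {v : E n}
    (hv : v ∈ feasibleCone W x₀) : sharpness g V * ‖g‖ * ‖v‖ ≤ ⟪g, v⟫ := by
  by_cases hv0 : v = 0
  · simp [hv0]
  obtain ⟨δ, hδ, h⟩ := exists_pos_add_mem_orthant hx.1.2
  have hn : 0 < ‖v‖ := norm_pos_iff.2 hv0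
  have hgn : 0 < ‖g‖ := norm_pos_iff.2 hg0
  set t := δ / ‖v‖ with ht
  have ht0 : 0 < t := by positivity
  have hf : x₀ + t • v ∈ feasible V := by
    refine ⟨(hV x₀ hx.1.1 _).2 (by simpa using W.smul_mem t hv.1), h _ ?_ ?_⟩
    · rw [norm_smul, Real.norm_of_nonneg ht0.le, ht, div_mul_cancel₀ _ hn.ne']
    · intro i hi
      simpa using mul_nonneg ht0.le (hv.2 i hi)
  have hle : sharpness g V ≤ Metric.infDist (x₀ + t • v) (V ∩ optHyperplane g V) /
      Metric.infDist (x₀ + t • v) (optimal g V) := by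
    refine csInf_le ⟨0, ?_⟩ ⟨x₀ + t • v, ⟨hf, fun ho => ?_⟩, rfl⟩
    · rintro _ ⟨y, -, rfl⟩
      exact div_nonneg Metric.infDist_nonneg Metric.infDist_nonneg
    · have := hu _ ho
      simp [ht0.ne', hv0] at this
  rw [infDist_inter_optHyperplane hV hg hg0 hx hf, optimal_eq_singleton hx hu,
    Metric.infDist_singleton, dist_eq_norm, add_sub_cancel_left, real_inner_smul_right, norm_smul,
    Real.norm_of_nonneg ht0.le, div_div, le_div_iff₀ (by positivity)] at hle
  have : t * (sharpness g V * ‖g‖ * ‖v‖) ≤ t * ⟪g, v⟫ := by linarith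
  exact le_of_mul_le_mul_left this ht0

theorem sharpness_pos (hV : IsTranslate V W) (hg : g ∈ W) (hg0 : g ≠ 0)
    (hx : x₀ ∈ optimal g V) (hu : ∀ x ∈ optimal g V, x = x₀)
    (hne : (feasible V \ optimal g V).Nonempty) : 0 < sharpness g V := by
  obtain ⟨m, hm, hmg⟩ := exists_pos_mul_norm_le_inner hV hx hu
  have hgn : 0 < ‖g‖ := norm_pos_iff.2 hg0
  refine lt_of_lt_of_le (div_pos hm hgn) (le_csInf (hne.image _) ?_)
  rintro _ ⟨x, ⟨hxF, hxo⟩, rfl⟩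
  have hne0 : x - x₀ ≠ 0 := fun e => hxo (by rw [sub_eq_zero.1 e]; exact hx)
  have hn : 0 < ‖x - x₀‖ := norm_pos_iff.2 hne0
  change _ ≤ _ / _
  rw [infDist_inter_optHyperplane hV hg hg0 hx hxF, optimal_eq_singleton hx hu,
    Metric.infDist_singleton, dist_eq_norm, div_div, div_le_div_iff₀ hgn (by positivity)]
  have := hmg _ (feasible_sub_mem_feasibleCone hV hx hxF)
  nlinarith

theorem sharpness_le_one (hx : x₀ ∈ optimal g V) (hu : ∀ x ∈ optimal g V, x = x₀)
    (hne : (feasible V \ optimal g V).Nonempty) : sharpness g V ≤ 1 := by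
  obtain ⟨x, hx'⟩ := hne
  refine le_trans (csInf_le ⟨0, ?_⟩ (Set.mem_image_of_mem _ hx')) ?_
  · rintro _ ⟨y, -, rfl⟩
    exact div_nonneg Metric.infDist_nonneg Metric.infDist_nonneg
  · refine div_le_one_of_le₀ ?_ Metric.infDist_nonneg
    rw [optimal_eq_singleton hx hu]
    refine Metric.infDist_le_infDist_of_subset ?_ (Set.singleton_nonempty _)
    rw [Set.singleton_subset_iff]
    exact ⟨hx.1.1, (optValue_eq hx).symm⟩

end Unique

/-! ### Strictly complementary pairs: splitting of directions, global growth, Limiting Error Ratio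
-/

section Pair

variable {n : ℕ} {W : Submodule ℝ (E n)} {V : Set (E n)} {g x₀ s₀ : E n}

/-- With `B` the vectors vanishing on the zeros of `x₀`, the hypothesis says `Wᗮ ⊓ Bᗮ = ⊥`, that is
`W ⊔ B = ⊤`; the `W`-component of `u` then agrees with `u` on those zeros. -/
theorem exists_mem_eq_on_zeros (hd : ∀ w ∈ Wᗮ, (∀ i, x₀ i ≠ 0 → w i = 0) → w = 0) (u : E n) :
    ∃ v ∈ W, ∀ i, x₀ i = 0 → v i = u i := by
  let B : Submodule ℝ (E n) :=
    { carrier := {z | ∀ i, x₀ i = 0 → z i = 0}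
      add_mem' := fun {a b} ha hb i hi => by
        rw [PiLp.add_apply, ha i hi, hb i hi, add_zero]
      zero_mem' := fun i _ => rfl
      smul_mem' := fun c a ha i hi => by
        rw [PiLp.smul_apply, ha i hi, smul_zero] }
  have htop : W ⊔ B = ⊤ := by
    rw [← Submodule.orthogonal_eq_bot_iff, ← Submodule.inf_orthogonal, eq_bot_iff]
    rintro w ⟨hw, hwB⟩
    refine hd w hw fun i hi => ?_
    have hmem : EuclideanSpace.single i (1 : ℝ) ∈ B := fun j hj => by
      have : j ≠ i := fun e => hi (e ▸ hj)
      simp [this]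
    have := (Submodule.mem_orthogonal _ _).1 hwB _ hmem
    rw [EuclideanSpace.inner_single_left] at this
    simpa using this
  obtain ⟨v, hv, z, hz, hvz⟩ := Submodule.mem_sup.1 (htop ▸ Submodule.mem_top : u ∈ W ⊔ B)
  refine ⟨v, hv, fun i hi => ?_⟩
  rw [← hvz, PiLp.add_apply, hz i hi, add_zero]

theorem inner_eq_inner_of_sub_mem_orthogonal (hs : s₀ - g ∈ Wᗮ) {v : E n} (hv : v ∈ W) :
    ⟪g, v⟫ = ⟪s₀, v⟫ := by
  have h : ⟪v, s₀ - g⟫ = 0 := hs v hv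
  rw [inner_sub_right, real_inner_comm, real_inner_comm g] at h
  linarith

/-- Splitting a direction of `W` into directions of the feasible cone. -/
theorem exists_split {μ : ℝ} (hμ : 0 < μ) (hg0 : g ≠ 0) (hs : s₀ - g ∈ Wᗮ)
    (h2 : ∀ i, x₀ i ≠ 0 → s₀ i = 0)
    (hd : ∀ w ∈ Wᗮ, (∀ i, x₀ i ≠ 0 → w i = 0) → w = 0)
    (hμg : ∀ v ∈ feasibleCone W x₀, μ * ‖g‖ * ‖v‖ ≤ ⟪g, v⟫) {v : E n} (hv : v ∈ W) :
    ∃ v₁ ∈ feasibleCone W x₀, ∃ v₂ ∈ feasibleCone W x₀, v = v₁ - v₂ ∧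
      (μ * ‖g‖ * ‖v₁‖ ≤ ∑ i, s₀ i * max (v i) 0) ∧
      (μ * ‖g‖ * ‖v₂‖ ≤ ∑ i, s₀ i * max (-v i) 0) := by
  obtain ⟨v₁, hv₁, he₁⟩ := exists_mem_eq_on_zeros hd (WithLp.toLp 2 fun i => max (v i) 0)
  obtain ⟨v₂, hv₂, he₂⟩ := exists_mem_eq_on_zeros hd (WithLp.toLp 2 fun i => max (-v i) 0)
  have hc₁ : v₁ ∈ feasibleCone W x₀ := ⟨hv₁, fun i hi => by rw [he₁ i hi]; exact le_max_right _ _⟩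
  have hc₂ : v₂ ∈ feasibleCone W x₀ := ⟨hv₂, fun i hi => by rw [he₂ i hi]; exact le_max_right _ _⟩
  have hgn : 0 < ‖g‖ := norm_pos_iff.2 hg0
  refine ⟨v₁, hc₁, v₂, hc₂, ?_, ?_, ?_⟩
  · have hwW : v - (v₁ - v₂) ∈ W := W.sub_mem hv (W.sub_mem hv₁ hv₂)
    have hw0 : ∀ i, x₀ i = 0 → (v - (v₁ - v₂)) i = 0 := by
      intro i hi
      simp only [PiLp.sub_apply, he₁ i hi, he₂ i hi]
      rcases le_total (v i) 0 with h | h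
      · rw [max_eq_right h, max_eq_left (by linarith)]; ring
      · rw [max_eq_left h, max_eq_right (by linarith)]; ring
    -- The discrepancy vanishes on the zeros of `x₀` while `s₀` vanishes elsewhere, so it is a
    -- feasible direction of objective zero; growth forces it to be zero.
    have h3 := hμg _ ⟨hwW, fun i hi => (hw0 i hi).ge⟩
    rw [inner_eq_inner_of_sub_mem_orthogonal hs hwW, inner_eq_sum, Finset.sum_eq_zero] at h3
    · have : ‖v - (v₁ - v₂)‖ ≤ 0 := by
        by_contra hpos
        push Not at hpos
        have : 0 < μ * ‖g‖ * ‖v - (v₁ - v₂)‖ := by positivity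
        linarith
      exact sub_eq_zero.1 (norm_le_zero_iff.1 this)
    · intro i _
      by_cases hi : x₀ i = 0
      · rw [hw0 i hi, mul_zero]
      · rw [h2 i hi, zero_mul]
  · refine (hμg _ hc₁).trans_eq ?_
    rw [inner_eq_inner_of_sub_mem_orthogonal hs hv₁, inner_eq_sum]
    refine Finset.sum_congr rfl fun i _ => ?_
    by_cases hi : x₀ i = 0
    · rw [he₁ i hi]
    · rw [h2 i hi, zero_mul, zero_mul]
  · refine (hμg _ hc₂).trans_eq ?_
    rw [inner_eq_inner_of_sub_mem_orthogonal hs hv₂, inner_eq_sum]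
    refine Finset.sum_congr rfl fun i _ => ?_
    by_cases hi : x₀ i = 0
    · rw [he₂ i hi]
    · rw [h2 i hi, zero_mul, zero_mul]

/-- Sharpness controls only feasible directions. Adding its bounds for the two pieces of `v`
controls all of `W`, as needed for infeasible iterates. -/
theorem mul_norm_le_sum_abs {μ : ℝ} (hμ : 0 < μ) (hg0 : g ≠ 0) (hs : s₀ - g ∈ Wᗮ)
    (h2 : ∀ i, x₀ i ≠ 0 → s₀ i = 0)
    (hd : ∀ w ∈ Wᗮ, (∀ i, x₀ i ≠ 0 → w i = 0) → w = 0)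
    (hμg : ∀ v ∈ feasibleCone W x₀, μ * ‖g‖ * ‖v‖ ≤ ⟪g, v⟫) {v : E n} (hv : v ∈ W) :
    μ * ‖g‖ * ‖v‖ ≤ ∑ i, s₀ i * |v i| := by
  obtain ⟨v₁, -, v₂, -, he, h1, h2⟩ := exists_split hμ hg0 hs h2 hd hμg hv
  calc μ * ‖g‖ * ‖v‖ ≤ μ * ‖g‖ * (‖v₁‖ + ‖v₂‖) := by
        gcongr; rw [he]; exact norm_sub_le _ _
    _ ≤ (∑ i, s₀ i * max (v i) 0) + ∑ i, s₀ i * max (-v i) 0 := by linarith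
    _ = ∑ i, s₀ i * |v i| := by
        rw [← Finset.sum_add_distrib]
        refine Finset.sum_congr rfl fun i _ => ?_
        rw [← mul_add]
        congr 1
        rcases le_total (v i) 0 with h | h
        · rw [max_eq_right h, max_eq_left (by linarith), abs_of_nonpos h]; ring
        · rw [max_eq_left h, max_eq_right (by linarith), abs_of_nonneg h]; ring

theorem sum_mul_le_norm_mul_norm (s u : E n) : ∑ i, s i * u i ≤ ‖s‖ * ‖u‖ := by
  rw [← inner_eq_sum]; exact real_inner_le_norm _ _

/-- Stated for any vector below the negative part of `x`, so that it applies to the negative part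
restricted to the zeros of `x₀`. -/
theorem norm_negPart_le_infDist (x : E n) {u : E n} (hu : ∀ i, 0 ≤ u i ∧ u i ≤ max (-x i) 0) :
    ‖u‖ ≤ Metric.infDist x (orthant n) := by
  refine (Metric.le_infDist ⟨0, show (0 : E n) ∈ orthant n from fun i => le_refl (0 : ℝ)⟩).2 fun o ho => ?_
  rw [dist_eq_norm, EuclideanSpace.norm_eq, EuclideanSpace.norm_eq]
  refine Real.sqrt_le_sqrt (Finset.sum_le_sum fun i _ => ?_)
  rw [Real.norm_eq_abs, Real.norm_eq_abs, sq_abs, sq_abs, PiLp.sub_apply]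
  have h1 := hu i
  have h2 := ho i
  rcases le_total (-x i) 0 with h | h
  · rw [max_eq_right h] at h1
    have : u i = 0 := le_antisymm h1.2 h1.1
    rw [this]
    nlinarith [sq_nonneg (x i - o i)]
  · rw [max_eq_left h] at h1
    nlinarith

/-- Split `x - x₀ = v₁ - v₂`. Near `x₀` the point `x₀ + v₁` is feasible and lies at distance `‖v₂‖`
from `x`, while sharpness bounds `v₂` by the negative part of `x` on the zeros of `x₀`, hence by the
distance to the orthant. -/
theorem limitingErrorRatio_le {μ : ℝ} (hμ : 0 < μ) (hV : IsTranslate V W) (hg0 : g ≠ 0)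
    (hx : x₀ ∈ optimal g V) (hu : ∀ x ∈ optimal g V, x = x₀) (hs : s₀ - g ∈ Wᗮ)
    (h1 : ∀ i, x₀ i = 0 → 0 < s₀ i) (h2 : ∀ i, x₀ i ≠ 0 → s₀ i = 0)
    (hd : ∀ w ∈ Wᗮ, (∀ i, x₀ i ≠ 0 → w i = 0) → w = 0)
    (hμg : ∀ v ∈ feasibleCone W x₀, μ * ‖g‖ * ‖v‖ ≤ ⟪g, v⟫)
    (hge : 1 ≤ ‖s₀‖ / (μ * ‖g‖)) :
    limitingErrorRatio g V ≤ ‖s₀‖ / (μ * ‖g‖) := by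
  have hgn : 0 < ‖g‖ := norm_pos_iff.2 hg0
  have hμg0 : 0 < μ * ‖g‖ := by positivity
  have hs0 : ∀ i, 0 ≤ s₀ i := fun i => by
    by_cases hi : x₀ i = 0
    · exact (h1 i hi).le
    · exact (h2 i hi).ge
  have hr0 : ∀ x, 0 ≤ errorRatio V x := fun x => by
    unfold errorRatio
    split_ifs
    · exact zero_le_one
    · exact div_nonneg Metric.infDist_nonneg Metric.infDist_nonneg
  obtain ⟨δ, hδ, hδx⟩ := exists_pos_add_mem_orthant hx.1.2
  set C := ‖s₀‖ / (μ * ‖g‖) with hC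
  have hC0 : 0 < C := by linarith
  -- Since `‖v₁‖ ≤ C ‖x - x₀‖`, this radius keeps `‖v₁‖ ≤ δ`, within which `x₀ + v₁` stays in the
  -- orthant.
  have hloc : ∀ x ∈ V, ‖x - x₀‖ ≤ δ / C → errorRatio V x ≤ C := by
    intro x hxV hxδ
    unfold errorRatio
    split_ifs with hxF
    · exact hge
    have hvW : x - x₀ ∈ W := (hV x₀ hx.1.1 x).1 hxV
    obtain ⟨v₁, hc₁, v₂, hc₂, he, hb1, hb2⟩ := exists_split hμ hg0 hs h2 hd hμg hvW
    have hv₁ : ‖v₁‖ ≤ δ := by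
      have h4 : ∑ i, s₀ i * max ((x - x₀) i) 0 ≤ ‖s₀‖ * ‖x - x₀‖ := by
        refine (sum_mul_le_norm_mul_norm s₀ (posPart (x - x₀))).trans ?_
        gcongr
        rw [EuclideanSpace.norm_eq, EuclideanSpace.norm_eq]
        refine Real.sqrt_le_sqrt (Finset.sum_le_sum fun i _ => ?_)
        rw [Real.norm_eq_abs, Real.norm_eq_abs, sq_abs, sq_abs]
        change (max ((x - x₀) i) 0) ^ 2 ≤ _
        rcases le_total ((x - x₀) i) 0 with h | h
        · rw [max_eq_right h, zero_pow two_ne_zero]; positivity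
        · rw [max_eq_left h]
      have h5 : ‖v₁‖ ≤ C * ‖x - x₀‖ := by
        rw [hC, div_mul_eq_mul_div, le_div_iff₀ hμg0]
        linarith
      calc ‖v₁‖ ≤ C * ‖x - x₀‖ := h5
        _ ≤ C * (δ / C) := by gcongr
        _ = δ := by field_simp
    have hfeas : x₀ + v₁ ∈ feasible V :=
      ⟨(hV x₀ hx.1.1 _).2 (by simpa using hc₁.1), hδx _ hv₁ hc₁.2⟩
    refine div_le_of_le_mul₀ Metric.infDist_nonneg hC0.le ?_
    refine (Metric.infDist_le_dist_of_mem hfeas).trans ?_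
    have hxe : x - (x₀ + v₁) = -v₂ := by
      rw [sub_add_eq_sub_sub, he]; abel
    rw [dist_eq_norm, hxe, norm_neg, hC, div_mul_eq_mul_div, le_div_iff₀ hμg0]
    set u : E n := WithLp.toLp 2 fun i => if x₀ i = 0 then max (-(x - x₀) i) 0 else 0 with hudef
    have h6 : ∑ i, s₀ i * max (-(x - x₀) i) 0 = ∑ i, s₀ i * u i := by
      refine Finset.sum_congr rfl fun i _ => ?_
      by_cases hi : x₀ i = 0
      · simp [hudef, hi]
      · rw [h2 i hi, zero_mul, zero_mul]
    have h7 : ‖u‖ ≤ Metric.infDist x (orthant n) := by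
      refine norm_negPart_le_infDist x fun i => ?_
      by_cases hi : x₀ i = 0 <;> simp [hudef, hi]
    calc ‖v₂‖ * (μ * ‖g‖) ≤ ∑ i, s₀ i * max (-(x - x₀) i) 0 := by linarith
      _ ≤ ‖s₀‖ * ‖u‖ := h6.trans_le (sum_mul_le_norm_mul_norm _ _)
      _ ≤ ‖s₀‖ * Metric.infDist x (orthant n) := by gcongr
  set f : ℝ → ℝ := fun ε =>
    sSup (errorRatio V '' {x | x ∈ V ∧ Metric.infDist x (optimal g V) ≤ ε}) with hf
  have hbd : ∀ ε ≤ δ / C, ∀ r ∈ errorRatio V '' {x | x ∈ V ∧ Metric.infDist x (optimal g V) ≤ ε},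
      r ≤ C := by
    rintro ε hε _ ⟨x, ⟨hxV, hxε⟩, rfl⟩
    rw [optimal_eq_singleton hx hu, Metric.infDist_singleton, dist_eq_norm] at hxε
    exact hloc x hxV (hxε.trans hε)
  have hpos : 0 < δ / C := by positivity
  -- The suprema are monotone in `ε` where they are finite, so the one-sided limit exists and
  -- `limUnder` is that limit rather than a default value.
  have hmono : MonotoneOn f (Set.Ioo 0 (δ / C)) := by
    intro a ha b hb hab
    refine csSup_le_csSup ⟨C, hbd b hb.2.le⟩ ⟨_, x₀, ⟨hx.1.1, ?_⟩, rfl⟩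
      (Set.image_mono fun x hx' => ⟨hx'.1, hx'.2.trans hab⟩)
    rw [Metric.infDist_zero_of_mem hx]
    exact ha.1.le
  have ht := hmono.tendsto_nhdsWithin_Ioo_right (Set.nonempty_Ioo.2 hpos) ⟨0, by
    rintro _ ⟨ε, -, rfl⟩
    exact Real.sSup_nonneg (by rintro _ ⟨x, -, rfl⟩; exact hr0 x)⟩
  have hlim : limitingErrorRatio g V = sInf (f '' Set.Ioo 0 (δ / C)) := ht.limUnder_eq
  rw [hlim]
  refine le_of_tendsto ht ?_
  filter_upwards [Ioo_mem_nhdsGT hpos] with ε hε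
  exact Real.sSup_le (hbd ε hε.2.le) hC0.le

end Pair

/-! ### Singular value bounds -/

section Operator

variable {m n : ℕ} (A : Matrix (Fin m) (Fin n) ℝ)

theorem appT_eq_adjoint : appT A = LinearMap.adjoint (app A) := by
  rw [appT, app, ← Matrix.toEuclideanLin_conjTranspose_eq_adjoint,
    Matrix.conjTranspose_eq_transpose_of_trivial]

theorem inner_app_left (x : E n) (y : E m) : ⟪app A x, y⟫ = ⟪x, appT A y⟫ := by
  rw [appT_eq_adjoint, LinearMap.adjoint_inner_right]

/-- Expand `⟪AᵀA x, x⟫` in an orthonormal eigenbasis of `AᵀA`; both singular value bounds are read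
off from this. -/
theorem norm_sq_app_eq_sum (x : E n) :
    ‖app A x‖ ^ 2 = ∑ i : Fin (Module.finrank ℝ (E n)), (app A).singularValues i ^ 2 *
      ⟪(app A).isSymmetric_adjoint_comp_self.eigenvectorBasis rfl i, x⟫ ^ 2 := by
  set T := app A with hT
  set bs := T.isSymmetric_adjoint_comp_self.eigenvectorBasis rfl with hbs
  have h1 : ‖T x‖ ^ 2 = ⟪(LinearMap.adjoint T ∘ₗ T) x, x⟫ := by
    rw [LinearMap.comp_apply, LinearMap.adjoint_inner_left, real_inner_self_eq_norm_sq]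
  rw [h1, ← bs.sum_inner_mul_inner]
  refine Finset.sum_congr rfl fun i _ => ?_
  rw [T.isSymmetric_adjoint_comp_self x, T.isSymmetric_adjoint_comp_self.apply_eigenvectorBasis,
    T.sq_singularValues_fin rfl i, real_inner_comm]
  simp only [RCLike.ofReal_real_eq_id, id_eq, real_inner_smul_left]
  ring

theorem finite_posSingularValues : (posSingularValues A).Finite := by
  refine ((app A).singularValues.finite_range).subset ?_
  rintro t ⟨-, i, hi⟩
  exact ⟨i, hi⟩

theorem lamMax_nonneg : 0 ≤ lamMax A := by
  refine Real.sSup_nonneg ?_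
  rintro t ⟨-, i, rfl⟩
  exact (app A).singularValues_nonneg i

theorem norm_app_le (x : E n) : ‖app A x‖ ≤ lamMax A * ‖x‖ := by
  refine le_of_sq_le_sq ?_ (mul_nonneg (lamMax_nonneg A) (norm_nonneg x))
  rw [norm_sq_app_eq_sum, mul_pow,
    ← ((app A).isSymmetric_adjoint_comp_self.eigenvectorBasis rfl).sum_sq_norm_inner_right x,
    Finset.mul_sum]
  refine Finset.sum_le_sum fun i _ => ?_
  rw [Real.norm_eq_abs, sq_abs]
  refine mul_le_mul_of_nonneg_right ?_ (sq_nonneg _)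
  refine pow_le_pow_left₀ ((app A).singularValues_nonneg i) ?_ 2
  by_cases h : (app A).singularValues i = 0
  · rw [h]; exact lamMax_nonneg A
  · exact le_csSup (finite_posSingularValues A).bddAbove ⟨h, i, rfl⟩

/-- Basis vectors with singular value zero lie in the kernel, so `x` has no component along them. -/
theorem lamMin_mul_norm_le {x : E n} (hx : x ∈ (vecVp A)ᗮ) (hpos : 0 ≤ lamMin A) :
    lamMin A * ‖x‖ ≤ ‖app A x‖ := by
  refine le_of_sq_le_sq ?_ (norm_nonneg _)
  rw [norm_sq_app_eq_sum, mul_pow,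
    ← ((app A).isSymmetric_adjoint_comp_self.eigenvectorBasis rfl).sum_sq_norm_inner_right x,
    Finset.mul_sum]
  refine Finset.sum_le_sum fun i _ => ?_
  rw [Real.norm_eq_abs, sq_abs]
  by_cases h : (app A).singularValues i = 0
  · have hker : (app A).isSymmetric_adjoint_comp_self.eigenvectorBasis rfl i ∈ vecVp A := by
      rw [vecVp, LinearMap.mem_ker, ← norm_eq_zero, ← sq_eq_zero_iff, norm_sq_app_eq_sum]
      refine Finset.sum_eq_zero fun j _ => ?_
      by_cases hj : j = i
      · rw [hj, h]; ring
      · rw [((app A).isSymmetric_adjoint_comp_self.eigenvectorBasis rfl).inner_eq_zero hj]; ring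
    rw [hx _ hker]
    simp
  · refine mul_le_mul_of_nonneg_right (pow_le_pow_left₀ hpos ?_ 2) (sq_nonneg _)
    exact csInf_le (finite_posSingularValues A).bddBelow ⟨h, i, rfl⟩

theorem lamMin_mem (hA : app A ≠ 0) : lamMin A ∈ posSingularValues A := by
  refine Set.Nonempty.csInf_mem ?_ (finite_posSingularValues A)
  have : (app A).singularValues ≠ 0 := fun h => hA ((app A).singularValues_eq_zero_iff.1 h)
  obtain ⟨i, hi⟩ := Finsupp.ne_iff.1 this
  exact ⟨_, hi, i, rfl⟩

theorem lamMin_pos (hA : app A ≠ 0) : 0 < lamMin A := by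
  obtain ⟨h0, i, hi⟩ := lamMin_mem A hA
  exact lt_of_le_of_ne (hi ▸ (app A).singularValues_nonneg i) (Ne.symm h0)

theorem lamMin_le_lamMax (hA : app A ≠ 0) : lamMin A ≤ lamMax A :=
  le_csSup (finite_posSingularValues A).bddAbove (lamMin_mem A hA)

theorem appT_mem_orthogonal (y : E m) : appT A y ∈ (vecVp A)ᗮ := by
  intro w hw
  rw [← inner_app_left, LinearMap.mem_ker.1 hw, inner_zero_left]

theorem norm_appT_le (y : E m) : ‖appT A y‖ ≤ lamMax A * ‖y‖ := by
  by_cases h : appT A y = 0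
  · rw [h, norm_zero]; exact mul_nonneg (lamMax_nonneg A) (norm_nonneg y)
  have hn : 0 < ‖appT A y‖ := norm_pos_iff.2 h
  have h1 : ‖appT A y‖ ^ 2 ≤ lamMax A * ‖appT A y‖ * ‖y‖ := by
    rw [← real_inner_self_eq_norm_sq, ← inner_app_left]
    refine (real_inner_le_norm _ _).trans ?_
    gcongr
    exact norm_app_le A _
  nlinarith

theorem exists_mem_orthogonal_app_eq (x : E n) : ∃ v ∈ (vecVp A)ᗮ, app A v = app A x := by
  obtain ⟨w, hw, v, hv, hx⟩ := (vecVp A).exists_add_mem_mem_orthogonal x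
  refine ⟨v, hv, ?_⟩
  rw [hx, map_add, LinearMap.mem_ker.1 hw, zero_add]

/-- Write `y = A v` with `v ⟂ ker A`; then `‖y‖² = ⟪v, Aᵀ y⟫` and `‖v‖ ≤ ‖y‖ / λ_min`. It applies to
all dual iterates, since PDHG started at `0` keeps them in the range of `A`. -/
theorem lamMin_mul_norm_le_appT (hA : app A ≠ 0) {y : E m} (hy : y ∈ LinearMap.range (app A)) :
    lamMin A * ‖y‖ ≤ ‖appT A y‖ := by
  obtain ⟨x, rfl⟩ := hy
  obtain ⟨v, hv, hvx⟩ := exists_mem_orthogonal_app_eq A x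
  rw [← hvx]
  by_cases h : app A v = 0
  · rw [h]; simp
  have hn : 0 < ‖app A v‖ := norm_pos_iff.2 h
  have h1 : ‖app A v‖ ^ 2 ≤ ‖v‖ * ‖appT A (app A v)‖ := by
    rw [← real_inner_self_eq_norm_sq, inner_app_left]
    exact real_inner_le_norm _ _
  have h2 := lamMin_mul_norm_le A hv (lamMin_pos A hA).le
  have h3 : 0 ≤ ‖appT A (app A v)‖ := norm_nonneg _
  have h4 : lamMin A * ‖app A v‖ ^ 2 ≤ ‖app A v‖ * ‖appT A (app A v)‖ := by
    have := lamMin_pos A hA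
    calc lamMin A * ‖app A v‖ ^ 2 ≤ lamMin A * (‖v‖ * ‖appT A (app A v)‖) := by gcongr
      _ = lamMin A * ‖v‖ * ‖appT A (app A v)‖ := by ring
      _ ≤ _ := by gcongr
  nlinarith

/-- Every vector of `(ker A)ᗮ` is `Aᵀ y` for some `y` in the range of `A`. -/
theorem exists_appT_eq {w : E n} (hw : w ∈ (vecVp A)ᗮ) :
    ∃ y ∈ LinearMap.range (app A), appT A y = w := by
  have h1 : w ∈ LinearMap.range (appT A) := by
    rw [← (LinearMap.range (appT A)).orthogonal_orthogonal]
    intro u hu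
    refine hw u ?_
    rw [vecVp, LinearMap.mem_ker, ← inner_self_eq_zero (𝕜 := ℝ), inner_app_left, real_inner_comm]
    exact hu _ ⟨_, rfl⟩
  obtain ⟨y, hy⟩ := h1
  obtain ⟨a, ha, d, hd, he⟩ := (LinearMap.range (app A)).exists_add_mem_mem_orthogonal y
  refine ⟨a, ha, ?_⟩
  have hd0 : appT A d = 0 := by
    rw [← inner_self_eq_zero (𝕜 := ℝ), ← inner_app_left]
    exact hd _ ⟨_, rfl⟩
  rw [← hy, he, map_add, hd0, add_zero]

end Operator

/-! ### The PDHG norm and the ergodic gap bound -/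

/-- Step-sizes are positive with `2 √(τσ) λ_max ≤ 1`. -/
structure IsStepSize {m n : ℕ} (A : Matrix (Fin m) (Fin n) ℝ) (τ σ : ℝ) : Prop where
  tau_pos : 0 < τ
  sigma_pos : 0 < σ
  le_one : 2 * lamMax A * (√τ * √σ) ≤ 1

section PDHG

variable {m n : ℕ} (A : Matrix (Fin m) (Fin n) ℝ) (b : E m) (c : E n) (τ σ : ℝ)

/-- The quadratic form whose square root is `normM`. -/
noncomputable def quadM (z : E n × E m) : ℝ :=
  ‖z.1‖ ^ 2 / τ + 2 * ⟪app A z.1, z.2⟫ + ‖z.2‖ ^ 2 / σ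

/-- The symmetric bilinear form associated with `quadM`. -/
noncomputable def bilinM (z w : E n × E m) : ℝ :=
  ⟪z.1, w.1⟫ / τ + ⟪app A z.1, w.2⟫ + ⟪app A w.1, z.2⟫ + ⟪z.2, w.2⟫ / σ

/-- The saddle gap `L(x, y') - L(x', y)`. -/
noncomputable def saddleGap (z z' : E n × E m) : ℝ :=
  lagrangian A b c z.1 z'.2 - lagrangian A b c z'.1 z.2

theorem quadM_add (z w : E n × E m) :
    quadM A τ σ (z + w) = quadM A τ σ z + 2 * bilinM A τ σ z w + quadM A τ σ w := by
  simp only [quadM, bilinM, Prod.fst_add, Prod.snd_add, norm_add_sq_real, map_add,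
    inner_add_left, inner_add_right]
  ring

theorem quadM_smul (t : ℝ) (z : E n × E m) : quadM A τ σ (t • z) = t ^ 2 * quadM A τ σ z := by
  simp only [quadM, Prod.smul_fst, Prod.smul_snd, norm_smul, map_smul, real_inner_smul_left,
    real_inner_smul_right, mul_pow, Real.norm_eq_abs, sq_abs]
  ring

theorem bilinM_smul_right (t : ℝ) (z w : E n × E m) :
    bilinM A τ σ z (t • w) = t * bilinM A τ σ z w := by
  simp only [bilinM, Prod.smul_fst, Prod.smul_snd, map_smul, real_inner_smul_left,
    real_inner_smul_right]
  ring

variable {A τ σ}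

/-- The factor `2` in the step-size condition makes the cross term at most `a b`, where `a = ‖x‖ /
√τ` and `b = ‖y‖ / √σ`. Hence the squared norm lies between `(a² + b²) / 2` and `(a + b)²`. -/
theorem IsStepSize.abs_inner_le (h : IsStepSize A τ σ) (z : E n × E m) :
    |2 * ⟪app A z.1, z.2⟫| ≤ ‖z.1‖ / √τ * (‖z.2‖ / √σ) := by
  have h1 := Real.sqrt_pos.2 h.tau_pos
  have h2 := Real.sqrt_pos.2 h.sigma_pos
  have h3 : |⟪app A z.1, z.2⟫| ≤ lamMax A * ‖z.1‖ * ‖z.2‖ :=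
    (abs_real_inner_le_norm _ _).trans (by gcongr; exact norm_app_le A _)
  rw [abs_mul, abs_two, div_mul_div_comm, le_div_iff₀ (by positivity)]
  calc 2 * |⟪app A z.1, z.2⟫| * (√τ * √σ) ≤ 2 * (lamMax A * ‖z.1‖ * ‖z.2‖) * (√τ * √σ) := by
        gcongr
    _ = (2 * lamMax A * (√τ * √σ)) * (‖z.1‖ * ‖z.2‖) := by ring
    _ ≤ 1 * (‖z.1‖ * ‖z.2‖) := by gcongr; exact h.le_one
    _ = _ := one_mul _

theorem IsStepSize.quadM_eq (h : IsStepSize A τ σ) (z : E n × E m) :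
    quadM A τ σ z = (‖z.1‖ / √τ) ^ 2 + 2 * ⟪app A z.1, z.2⟫ + (‖z.2‖ / √σ) ^ 2 := by
  rw [quadM, div_pow, div_pow, Real.sq_sqrt h.tau_pos.le, Real.sq_sqrt h.sigma_pos.le]

theorem IsStepSize.half_le_quadM (h : IsStepSize A τ σ) (z : E n × E m) :
    ((‖z.1‖ / √τ) ^ 2 + (‖z.2‖ / √σ) ^ 2) / 2 ≤ quadM A τ σ z := by
  rw [h.quadM_eq]
  have h1 := (abs_le.1 (h.abs_inner_le z)).1
  nlinarith [sq_nonneg (‖z.1‖ / √τ - ‖z.2‖ / √σ)]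

theorem IsStepSize.quadM_nonneg (h : IsStepSize A τ σ) (z : E n × E m) : 0 ≤ quadM A τ σ z :=
  le_trans (by positivity) (h.half_le_quadM z)

theorem IsStepSize.normM_sq (h : IsStepSize A τ σ) (z : E n × E m) :
    normM A τ σ z ^ 2 = quadM A τ σ z := Real.sq_sqrt (h.quadM_nonneg z)

theorem normM_nonneg (z : E n × E m) : 0 ≤ normM A τ σ z := Real.sqrt_nonneg _

theorem IsStepSize.normM_le (h : IsStepSize A τ σ) (z : E n × E m) :
    normM A τ σ z ≤ ‖z.1‖ / √τ + ‖z.2‖ / √σ := by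
  refine le_of_sq_le_sq ?_ (by positivity)
  rw [h.normM_sq, h.quadM_eq]
  have h1 := (abs_le.1 (h.abs_inner_le z)).2
  have h2 : 0 ≤ ‖z.1‖ / √τ * (‖z.2‖ / √σ) := by positivity
  nlinarith

theorem IsStepSize.norm_fst_le (h : IsStepSize A τ σ) (z : E n × E m) :
    ‖z.1‖ ≤ 2 * √τ * normM A τ σ z := by
  have h1 := Real.sqrt_pos.2 h.tau_pos
  have h3 : ‖z.1‖ / √τ ≤ 2 * normM A τ σ z := by
    refine le_of_sq_le_sq ?_ (mul_nonneg two_pos.le (normM_nonneg z))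
    rw [mul_pow, h.normM_sq]
    nlinarith [h.half_le_quadM z, h.quadM_nonneg z, sq_nonneg (‖z.2‖ / √σ)]
  rw [div_le_iff₀ h1] at h3
  linarith

theorem IsStepSize.norm_snd_le (h : IsStepSize A τ σ) (z : E n × E m) :
    ‖z.2‖ ≤ 2 * √σ * normM A τ σ z := by
  have h1 := Real.sqrt_pos.2 h.sigma_pos
  have h3 : ‖z.2‖ / √σ ≤ 2 * normM A τ σ z := by
    refine le_of_sq_le_sq ?_ (mul_nonneg two_pos.le (normM_nonneg z))
    rw [mul_pow, h.normM_sq]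
    nlinarith [h.half_le_quadM z, h.quadM_nonneg z, sq_nonneg (‖z.1‖ / √τ)]
  rw [div_le_iff₀ h1] at h3
  linarith

theorem IsStepSize.normM_smul (_h : IsStepSize A τ σ) (t : ℝ) (z : E n × E m) :
    normM A τ σ (t • z) = ‖t‖ * normM A τ σ z := by
  change √(quadM A τ σ (t • z)) = ‖t‖ * √(quadM A τ σ z)
  rw [quadM_smul, Real.sqrt_mul (sq_nonneg t), Real.sqrt_sq_eq_abs, Real.norm_eq_abs]

theorem IsStepSize.bilinM_le (h : IsStepSize A τ σ) (z w : E n × E m) :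
    bilinM A τ σ z w ≤ normM A τ σ z * normM A τ σ w := by
  have h1 : discrim (quadM A τ σ w) (2 * bilinM A τ σ z w) (quadM A τ σ z) ≤ 0 := by
    refine discrim_le_zero fun t => ?_
    have := h.quadM_nonneg (z + t • w)
    rw [quadM_add, quadM_smul, bilinM_smul_right] at this
    linarith
  refine le_of_sq_le_sq ?_ (mul_nonneg (normM_nonneg z) (normM_nonneg w))
  rw [mul_pow, h.normM_sq, h.normM_sq]
  rw [discrim] at h1
  linarith

theorem IsStepSize.normM_add_le (h : IsStepSize A τ σ) (z w : E n × E m) :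
    normM A τ σ (z + w) ≤ normM A τ σ z + normM A τ σ w := by
  refine le_of_sq_le_sq ?_ (add_nonneg (normM_nonneg z) (normM_nonneg w))
  rw [h.normM_sq, quadM_add, ← h.normM_sq, ← h.normM_sq]
  linarith [h.bilinM_le z w]

/-- `normM` as a seminorm. -/
noncomputable def IsStepSize.seminorm (h : IsStepSize A τ σ) : Seminorm ℝ (E n × E m) :=
  Seminorm.of (normM A τ σ) h.normM_add_le h.normM_smul

theorem IsStepSize.normM_sub_rev (h : IsStepSize A τ σ) (z w : E n × E m) :
    normM A τ σ (z - w) = normM A τ σ (w - z) := map_sub_rev h.seminorm z w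

theorem IsStepSize.normM_sub_le (h : IsStepSize A τ σ) (z w u : E n × E m) :
    normM A τ σ (z - w) ≤ normM A τ σ (z - u) + normM A τ σ (u - w) := by
  have := h.normM_add_le (z - u) (u - w)
  rwa [sub_add_sub_cancel] at this

variable {b c}

theorem pdhgStep_fst_mem (z : E n × E m) : (pdhgStep A b c τ σ z).1 ∈ orthant n :=
  fun _ => le_max_right _ _

theorem pdhgStep_snd_mem (hb : b ∈ LinearMap.range (app A)) {z : E n × E m}
    (hz : z.2 ∈ LinearMap.range (app A)) : (pdhgStep A b c τ σ z).2 ∈ LinearMap.range (app A) :=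
  add_mem hz (Submodule.smul_mem _ _ (sub_mem hb ⟨_, rfl⟩))

theorem inner_sub_posPart_nonneg (u : E n) {x : E n} (hx : x ∈ orthant n) :
    0 ≤ ⟪u - posPart u, posPart u - x⟫ := by
  rw [inner_eq_sum]
  refine Finset.sum_nonneg fun i _ => ?_
  change 0 ≤ (u i - max (u i) 0) * (max (u i) 0 - x i)
  have := hx i
  rcases le_total (u i) 0 with h | h
  · rw [max_eq_right h]; nlinarith
  · rw [max_eq_left h]; simp

/-- The proximal point inequality. The projection inequality handles the primal update and the dual
update is an identity; the extrapolation `2 x⁺ - x` is what makes the cross terms combine into the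
symmetric form `bilinM`. -/
theorem saddleGap_pdhgStep_le (h : IsStepSize A τ σ) (z : E n × E m) {z' : E n × E m}
    (hz' : z'.1 ∈ orthant n) :
    2 * saddleGap A b c (pdhgStep A b c τ σ z) z' ≤
      quadM A τ σ (z - z') - quadM A τ σ (pdhgStep A b c τ σ z - z') := by
  have hτ := h.tau_pos
  have hσ := h.sigma_pos
  set w := pdhgStep A b c τ σ z with hw
  have h1 : z - z' = (z - w) + (w - z') := by abel
  rw [h1, quadM_add]
  have h2 := h.quadM_nonneg (z - w)
  suffices saddleGap A b c w z' ≤ bilinM A τ σ (z - w) (w - z') by linarith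
  have h3 := inner_sub_posPart_nonneg (z.1 - τ • (c - appT A z.2)) hz'
  have hw1 : posPart (z.1 - τ • (c - appT A z.2)) = w.1 := rfl
  have hw2 : w.2 = z.2 + σ • (b - app A ((2 : ℝ) • w.1 - z.1)) := rfl
  rw [hw1] at h3
  have h4 : ⟪c, w.1 - z'.1⟫ - ⟪app A (w.1 - z'.1), z.2⟫ ≤ ⟪z.1 - w.1, w.1 - z'.1⟫ / τ := by
    rw [le_div_iff₀ hτ, inner_app_left]
    have : z.1 - τ • (c - appT A z.2) - w.1 = (z.1 - w.1) - τ • (c - appT A z.2) := by abel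
    rw [this, inner_sub_left (z.1 - w.1), real_inner_smul_left, inner_sub_left c,
      real_inner_comm (w.1 - z'.1) (appT A z.2)] at h3
    linarith
  have h5 : z.2 - w.2 = σ • (app A ((2 : ℝ) • w.1 - z.1) - b) := by
    rw [hw2]; module
  have h6 : ⟪z.2 - w.2, w.2 - z'.2⟫ / σ =
      ⟪app A ((2 : ℝ) • w.1 - z.1) - b, w.2 - z'.2⟫ := by
    rw [h5, real_inner_smul_left]; field_simp
  simp only [bilinM, Prod.fst_sub, Prod.snd_sub, saddleGap, lagrangian]
  rw [h6]
  simp only [map_sub, map_smul, inner_sub_left, inner_sub_right, real_inner_smul_left] at h4 ⊢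
  linarith

/-- Shows that the gap is affine in `z`, so that it commutes with averaging. -/
theorem saddleGap_eq (z z' : E n × E m) : saddleGap A b c z z' =
    ⟪c - appT A z'.2, z.1⟫ + ⟪app A z'.1 - b, z.2⟫ + (⟪b, z'.2⟫ - ⟪c, z'.1⟫) := by
  rw [saddleGap, lagrangian, lagrangian, inner_sub_left, inner_sub_left,
    real_inner_comm z.1 (appT A z'.2), ← inner_app_left]
  ring

theorem saddleGap_average (z z' : E n × E m) {k : ℕ} (hk : 1 ≤ k) :
    ∑ i ∈ Finset.range k, saddleGap A b c ((pdhgStep A b c τ σ)^[i + 1] z) z' =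
      k * saddleGap A b c (pdhgAverage A b c τ σ z k) z' := by
  have hk0 : (k : ℝ) ≠ 0 := by positivity
  simp only [saddleGap_eq, pdhgAverage, Prod.smul_fst, Prod.smul_snd, Prod.fst_sum, Prod.snd_sum,
    real_inner_smul_right, inner_sum, Finset.sum_add_distrib, Finset.sum_const, Finset.card_range,
    nsmul_eq_mul]
  field_simp

theorem saddleGap_average_le (h : IsStepSize A τ σ) (z : E n × E m) {z' : E n × E m}
    (hz' : z'.1 ∈ orthant n) {k : ℕ} (hk : 1 ≤ k) :
    saddleGap A b c (pdhgAverage A b c τ σ z k) z' ≤ normM A τ σ (z - z') ^ 2 / (2 * k) := by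
  have hk0 : (0 : ℝ) < k := by positivity
  rw [le_div_iff₀ (by positivity), h.normM_sq]
  have h1 : ∑ i ∈ Finset.range k, 2 * saddleGap A b c ((pdhgStep A b c τ σ)^[i + 1] z) z' ≤
      ∑ i ∈ Finset.range k, (quadM A τ σ ((pdhgStep A b c τ σ)^[i] z - z') -
        quadM A τ σ ((pdhgStep A b c τ σ)^[i + 1] z - z')) := by
    refine Finset.sum_le_sum fun i _ => ?_
    rw [Function.iterate_succ_apply']
    exact saddleGap_pdhgStep_le h _ hz'
  rw [Finset.sum_range_sub', ← Finset.mul_sum, saddleGap_average z z' hk] at h1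
  have := h.quadM_nonneg ((pdhgStep A b c τ σ)^[k] z - z')
  simp only [Function.iterate_zero, id_eq] at h1
  linarith

theorem pdhgAverage_fst_mem (z : E n × E m) (k : ℕ) :
    (pdhgAverage A b c τ σ z k).1 ∈ orthant n := by
  intro i
  simp only [pdhgAverage, Prod.smul_fst, Prod.fst_sum, PiLp.smul_apply, smul_eq_mul]
  refine mul_nonneg (by positivity) ?_
  rw [WithLp.ofLp_sum, Finset.sum_apply]
  refine Finset.sum_nonneg fun j _ => ?_
  rw [Function.iterate_succ_apply']
  exact pdhgStep_fst_mem _ i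

theorem pdhgAverage_snd_mem (hb : b ∈ LinearMap.range (app A)) {z : E n × E m}
    (hz : z.2 ∈ LinearMap.range (app A)) (k : ℕ) :
    (pdhgAverage A b c τ σ z k).2 ∈ LinearMap.range (app A) := by
  have hit : ∀ i, ((pdhgStep A b c τ σ)^[i] z).2 ∈ LinearMap.range (app A) := by
    intro i
    induction i with
    | zero => exact hz
    | succ i ih => rw [Function.iterate_succ_apply']; exact pdhgStep_snd_mem hb ih
  simp only [pdhgAverage, Prod.smul_snd, Prod.snd_sum]
  exact Submodule.smul_mem _ _ (Submodule.sum_mem _ fun i _ => hit (i + 1))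

/-- `w` is a saddle point. -/
def IsSaddle {m n : ℕ} (A : Matrix (Fin m) (Fin n) ℝ) (b : E m) (c : E n) (w : E n × E m) : Prop :=
  w.1 ∈ orthant n ∧ ∀ z : E n × E m, z.1 ∈ orthant n → 0 ≤ saddleGap A b c z w

/-- Against a saddle point the gap is nonnegative, so the one-step inequality makes the distance
nonincreasing; the average inherits the bound by convexity. -/
theorem normM_pdhgAverage_sub_le (h : IsStepSize A τ σ) {w : E n × E m} (hw : IsSaddle A b c w)
    (z : E n × E m) {k : ℕ} (hk : 1 ≤ k) :
    normM A τ σ (pdhgAverage A b c τ σ z k - w) ≤ normM A τ σ (z - w) := by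
  have hk0 : (0 : ℝ) < k := by positivity
  have hit : ∀ i, normM A τ σ ((pdhgStep A b c τ σ)^[i] z - w) ≤ normM A τ σ (z - w) := by
    intro i
    induction i with
    | zero => exact le_rfl
    | succ i ih =>
      refine le_trans ?_ ih
      rw [Function.iterate_succ_apply']
      refine Real.sqrt_le_sqrt ?_
      have h1 := saddleGap_pdhgStep_le (b := b) (c := c) h ((pdhgStep A b c τ σ)^[i] z) hw.1
      have h2 := hw.2 _ (pdhgStep_fst_mem (A := A) (b := b) (c := c) (τ := τ) (σ := σ)
        ((pdhgStep A b c τ σ)^[i] z))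
      change quadM A τ σ _ ≤ quadM A τ σ _
      linarith
  have h1 : pdhgAverage A b c τ σ z k - w =
      (k : ℝ)⁻¹ • ∑ i ∈ Finset.range k, ((pdhgStep A b c τ σ)^[i + 1] z - w) := by
    rw [Finset.sum_sub_distrib, Finset.sum_const, Finset.card_range, smul_sub, pdhgAverage,
      ← Nat.cast_smul_eq_nsmul ℝ k w, smul_smul, inv_mul_cancel₀ hk0.ne', one_smul]
  rw [h1, h.normM_smul, Real.norm_of_nonneg (by positivity)]
  have h2 : normM A τ σ (∑ i ∈ Finset.range k, ((pdhgStep A b c τ σ)^[i + 1] z - w)) ≤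
      ∑ i ∈ Finset.range k, normM A τ σ ((pdhgStep A b c τ σ)^[i + 1] z - w) :=
    Finset.le_sum_of_subadditive _ (map_zero h.seminorm).le h.normM_add_le _ _
  have h3 := h2.trans (Finset.sum_le_sum fun i _ => hit (i + 1))
  rw [Finset.sum_const, Finset.card_range, nsmul_eq_mul] at h3
  calc (k : ℝ)⁻¹ * _ ≤ (k : ℝ)⁻¹ * (k * normM A τ σ (z - w)) := by gcongr
    _ = _ := by field_simp

/-- The radius `r` may exceed the distance actually travelled; this freedom settles the case where
the average equals the starting point. -/
theorem saddleGap_average_le_of_normM_le (h : IsStepSize A τ σ) (z : E n × E m) {k : ℕ}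
    (hk : 1 ≤ k) {r : ℝ} (hr : normM A τ σ (pdhgAverage A b c τ σ z k - z) ≤ r) {z' : E n × E m}
    (hz' : z'.1 ∈ orthant n) (hz'r : normM A τ σ (z' - pdhgAverage A b c τ σ z k) ≤ r) :
    saddleGap A b c (pdhgAverage A b c τ σ z k) z' ≤ 2 * r ^ 2 / k := by
  have hk0 : (0 : ℝ) < k := by positivity
  refine (saddleGap_average_le h z hz' hk).trans ?_
  have h1 : normM A τ σ (z - z') ≤ 2 * r := by
    rw [h.normM_sub_rev]
    linarith [h.normM_sub_le z' z (pdhgAverage A b c τ σ z k)]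
  rw [div_le_div_iff₀ (by positivity) hk0]
  have h2 : normM A τ σ (z - z') ^ 2 ≤ (2 * r) ^ 2 := pow_le_pow_left₀ (normM_nonneg _) h1 2
  nlinarith

theorem normalizedGap_average_le (h : IsStepSize A τ σ) (z : E n × E m) {k : ℕ} (hk : 1 ≤ k) :
    normalizedGap A b c τ σ (normM A τ σ (pdhgAverage A b c τ σ z k - z))
      (pdhgAverage A b c τ σ z k) ≤ 2 * normM A τ σ (pdhgAverage A b c τ σ z k - z) / k := by
  have hk0 : (0 : ℝ) < k := by positivity
  set r := normM A τ σ (pdhgAverage A b c τ σ z k - z) with hr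
  have hr0 : 0 ≤ r := normM_nonneg _
  rcases hr0.eq_or_lt with h0 | h0
  · simp [normalizedGap, ← h0]
  rw [normalizedGap]
  have h1 : sSup ((fun z' : E n × E m =>
      lagrangian A b c (pdhgAverage A b c τ σ z k).1 z'.2 -
        lagrangian A b c z'.1 (pdhgAverage A b c τ σ z k).2) ''
      {z' | z'.1 ∈ orthant n ∧ normM A τ σ (z' - pdhgAverage A b c τ σ z k) ≤ r}) ≤
      2 * r ^ 2 / k := by
    refine Real.sSup_le ?_ (by positivity)
    rintro _ ⟨z', ⟨hz', hz'r⟩, rfl⟩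
    exact saddleGap_average_le_of_normM_le h z hk hr.symm.le hz' hz'r
  calc 1 / r * _ ≤ 1 / r * (2 * r ^ 2 / k) := by gcongr
    _ = 2 * r / k := by field_simp

/-- The ergodic bound makes the supremum in `normalizedGap` finite, so it does dominate each of its
members. -/
theorem saddleGap_le_mul_normalizedGap (h : IsStepSize A τ σ) (z : E n × E m) {k : ℕ} (hk : 1 ≤ k)
    (hr : 0 < normM A τ σ (pdhgAverage A b c τ σ z k - z)) {z' : E n × E m}
    (hz' : z'.1 ∈ orthant n) (hz'r : normM A τ σ (z' - pdhgAverage A b c τ σ z k) ≤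
      normM A τ σ (pdhgAverage A b c τ σ z k - z)) :
    saddleGap A b c (pdhgAverage A b c τ σ z k) z' ≤
      normM A τ σ (pdhgAverage A b c τ σ z k - z) *
        normalizedGap A b c τ σ (normM A τ σ (pdhgAverage A b c τ σ z k - z))
          (pdhgAverage A b c τ σ z k) := by
  set r := normM A τ σ (pdhgAverage A b c τ σ z k - z) with hrd
  rw [normalizedGap, ← mul_assoc, mul_one_div_cancel hr.ne', one_mul]
  refine le_csSup ⟨2 * r ^ 2 / k, ?_⟩ ⟨z', ⟨hz', hz'r⟩, rfl⟩
  rintro _ ⟨z'', ⟨hz'', hz''r⟩, rfl⟩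
  exact saddleGap_average_le_of_normM_le h z hk hrd.symm.le hz'' hz''r

end PDHG

/-! ### The distance to the optima is bounded by the normalized duality gap -/

/-- A complementary pair of primal-dual solutions with multiplier `ys`, and growth of the
objectives away from it with constants `μp`, `μd`. -/
structure SharpPair {m n : ℕ} (A : Matrix (Fin m) (Fin n) ℝ) (b : E m) (c q xs ss : E n)
    (ys : E m) (μp μd : ℝ) : Prop where
  app_ne : app A ≠ 0
  c_ne : c ≠ 0
  q_mem : q ∈ (vecVp A)ᗮ
  q_ne : q ≠ 0
  app_q : app A q = b
  app_xs : app A xs = b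
  xs_nonneg : xs ∈ orthant n
  ss_mem : ss - c ∈ (vecVp A)ᗮ
  ss_nonneg : ss ∈ orthant n
  compl : ∀ i, xs i = 0 ∨ ss i = 0
  ys_mem : ys ∈ LinearMap.range (app A)
  appT_ys : appT A ys = c - ss
  mup_pos : 0 < μp
  mud_pos : 0 < μd
  growth_p : ∀ v ∈ vecVp A, μp * ‖c‖ * ‖v‖ ≤ ∑ i, ss i * |v i|
  growth_d : ∀ w ∈ (vecVp A)ᗮ, μd * ‖q‖ * ‖w‖ ≤ ∑ i, xs i * |w i|

/-- The weights `h = √(2κ)` and `p = √ω` describing the step-sizes. -/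
structure IsWeight {m n : ℕ} (A : Matrix (Fin m) (Fin n) ℝ) (τ σ h p : ℝ) : Prop where
  h_pos : 0 < h
  p_pos : 0 < p
  h_sq : h ^ 2 * lamMin A = 2 * lamMax A
  sqrt_tau : √τ = 1 / (h * p)
  sqrt_sigma : √σ = p / (h * lamMin A)

theorem sum_mul_abs_le {n : ℕ} (s v : E n) : ∑ i, s i * |v i| ≤ ‖s‖ * ‖v‖ := by
  have h := sum_mul_le_norm_mul_norm s (WithLp.toLp 2 fun i => |v i|)
  have h2 : ‖(WithLp.toLp 2 fun i => |v i| : E n)‖ = ‖v‖ := by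
    rw [EuclideanSpace.norm_eq, EuclideanSpace.norm_eq]
    simp
  rwa [h2] at h

section Error

variable {m n : ℕ} {A : Matrix (Fin m) (Fin n) ℝ} {b : E m} {c q xs ss : E n} {ys : E m}
  {μp μd τ σ h p : ℝ}

theorem SharpPair.inner_xs_ss (D : SharpPair A b c q xs ss ys μp μd) : ⟪xs, ss⟫ = 0 := by
  rw [inner_eq_sum]
  refine Finset.sum_eq_zero fun i _ => ?_
  rcases D.compl i with h | h <;> simp [h]

theorem SharpPair.inner_b_ys (D : SharpPair A b c q xs ss ys μp μd) : ⟪b, ys⟫ = ⟪c, xs⟫ := by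
  rw [← D.app_xs, inner_app_left, D.appT_ys, inner_sub_right, D.inner_xs_ss, sub_zero,
    real_inner_comm]

theorem SharpPair.saddleGap_eq (D : SharpPair A b c q xs ss ys μp μd) (z : E n × E m) :
    saddleGap A b c z (xs, ys) = ⟪ss, z.1⟫ := by
  rw [RPDHG.saddleGap_eq]
  simp only
  rw [D.appT_ys, D.app_xs, D.inner_b_ys]
  simp

theorem SharpPair.isSaddle (D : SharpPair A b c q xs ss ys μp μd) :
    IsSaddle A b c (xs, ys) := by
  refine ⟨D.xs_nonneg, fun z hz => ?_⟩
  rw [D.saddleGap_eq, inner_eq_sum]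
  exact Finset.sum_nonneg fun i _ => mul_nonneg (D.ss_nonneg i) (hz i)

theorem saddleGap_add (z d : E n × E m) : saddleGap A b c z (z + d) =
    ⟪b - app A z.1, d.2⟫ - ⟪c - appT A z.2, d.1⟫ := by
  simp only [saddleGap, lagrangian, Prod.fst_add, Prod.snd_add, map_add, inner_add_left,
    inner_add_right, inner_sub_left]
  rw [real_inner_comm d.1 (appT A z.2), ← inner_app_left]
  ring

theorem IsWeight.normM_le (hw : IsWeight A τ σ h p) (hst : IsStepSize A τ σ)
    (hA : app A ≠ 0) {z : E n × E m} (hz : z.2 ∈ LinearMap.range (app A)) :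
    normM A τ σ z ≤ h * (p * ‖z.1‖ + ‖appT A z.2‖ / p) := by
  have hp := hw.p_pos
  have hh := hw.h_pos
  have hl := lamMin_pos A hA
  refine (hst.normM_le z).trans ?_
  rw [hw.sqrt_tau, hw.sqrt_sigma]
  have h1 := lamMin_mul_norm_le_appT A hA hz
  calc ‖z.1‖ / (1 / (h * p)) + ‖z.2‖ / (p / (h * lamMin A))
      = h * (p * ‖z.1‖ + (lamMin A * ‖z.2‖) / p) := by field_simp
    _ ≤ _ := by gcongr

/-- Consequences of a bound `r ρ` on the saddle gap over the ball of radius `r`. -/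
theorem residuals_le_of_saddleGap_le (hst : IsStepSize A τ σ) {z : E n × E m}
    (hz : z.1 ∈ orthant n) {r R ρ : ℝ} (hr : 0 < r) (hrR : r ≤ R) (hzR : normM A τ σ z ≤ R)
    (hgap : ∀ z' : E n × E m, z'.1 ∈ orthant n → normM A τ σ (z' - z) ≤ r →
      saddleGap A b c z z' ≤ r * ρ) :
    √σ * ‖b - app A z.1‖ ≤ ρ ∧ √τ * ‖posPart (-(c - appT A z.2))‖ ≤ ρ ∧
      ⟪c, z.1⟫ - ⟪b, z.2⟫ ≤ R * ρ := by
  have hsτ := Real.sqrt_pos.2 hst.tau_pos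
  have hsσ := Real.sqrt_pos.2 hst.sigma_pos
  have hgap' : ∀ d : E n × E m, (z + d).1 ∈ orthant n → normM A τ σ d ≤ r →
      ⟪b - app A z.1, d.2⟫ - ⟪c - appT A z.2, d.1⟫ ≤ r * ρ := by
    intro d hd hdr
    rw [← saddleGap_add]
    exact hgap _ hd (by rwa [add_sub_cancel_left])
  have hρ : 0 ≤ ρ := by
    have := hgap' 0 (by simpa using hz) (by simpa [normM] using hr.le)
    simp only [Prod.snd_zero, Prod.fst_zero, inner_zero_right, sub_zero] at this
    exact nonneg_of_mul_nonneg_right this hr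
  refine ⟨?_, ?_, ?_⟩
  · set e := b - app A z.1 with he
    by_cases h0 : e = 0
    · simpa [h0] using hρ
    have hn : 0 < ‖e‖ := norm_pos_iff.2 h0
    -- Three test displacements of `normM` at most `r`: along the primal residual, along the
    -- negative part of the slack (which preserves `x ≥ 0`), and towards the origin for the duality
    -- gap.
    have := hgap' (0, (r * √σ / ‖e‖) • e) (by simpa using hz) ?_
    · simp only [inner_zero_right, sub_zero, real_inner_smul_right,
        real_inner_self_eq_norm_sq] at this
      have h2 : r * √σ / ‖e‖ * ‖e‖ ^ 2 = r * (√σ * ‖e‖) := by field_simp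
      rw [h2] at this
      exact le_of_mul_le_mul_left this hr
    · refine (hst.normM_le _).trans_eq ?_
      simp only [norm_zero, zero_div, zero_add, norm_smul]
      rw [Real.norm_of_nonneg (by positivity)]
      field_simp
  · set s := c - appT A z.2 with hs
    set u := posPart (-s) with hu
    by_cases h0 : u = 0
    · simpa [h0] using hρ
    have hn : 0 < ‖u‖ := norm_pos_iff.2 h0
    have hu0 : ∀ i, 0 ≤ u i := fun i => le_max_right _ _
    have hsu : ⟪s, u⟫ = -‖u‖ ^ 2 := by
      rw [← real_inner_self_eq_norm_sq, inner_eq_sum, inner_eq_sum, ← Finset.sum_neg_distrib]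
      refine Finset.sum_congr rfl fun i _ => ?_
      change s i * max (-s i) 0 = -(max (-s i) 0 * max (-s i) 0)
      rcases le_total (-s i) 0 with h | h
      · rw [max_eq_right h]; ring
      · rw [max_eq_left h]; ring
    have := hgap' ((r * √τ / ‖u‖) • u, 0) (fun i => ?_) ?_
    · simp only [inner_zero_right, zero_sub, real_inner_smul_right, hsu] at this
      have h2 : -(r * √τ / ‖u‖ * -‖u‖ ^ 2) = r * (√τ * ‖u‖) := by field_simp
      rw [h2] at this
      exact le_of_mul_le_mul_left this hr
    · have : (z + ((r * √τ / ‖u‖) • u, 0)).1 i = z.1 i + (r * √τ / ‖u‖) * u i := rfl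
      rw [this]
      exact add_nonneg (hz i) (mul_nonneg (by positivity) (hu0 i))
    · refine (hst.normM_le _).trans_eq ?_
      simp only [norm_zero, zero_div, add_zero, norm_smul]
      rw [Real.norm_of_nonneg (by positivity)]
      field_simp
  · have hR : 0 < R := hr.trans_le hrR
    have ht1 : r / R ≤ 1 := (div_le_one hR).2 hrR
    have := hgap' (-(r / R) • z) (fun i => ?_) ?_
    · simp only [Prod.smul_snd, Prod.smul_fst, real_inner_smul_right, inner_sub_left] at this
      rw [inner_app_left, real_inner_comm z.1 (appT A z.2)] at this
      have h2 : r / R * (⟪c, z.1⟫ - ⟪b, z.2⟫) ≤ r * ρ := by linarith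
      rw [div_mul_eq_mul_div, div_le_iff₀ hR] at h2
      have h3 : r * (⟪c, z.1⟫ - ⟪b, z.2⟫) ≤ r * (R * ρ) := by linarith
      exact le_of_mul_le_mul_left h3 hr
    · have : (z + -(r / R) • z).1 i = (1 - r / R) * z.1 i := by
        change z.1 i + -(r / R) * z.1 i = _
        ring
      rw [this]
      exact mul_nonneg (by linarith) (hz i)
    · rw [hst.normM_smul, norm_neg, Real.norm_of_nonneg (by positivity)]
      calc r / R * normM A τ σ z ≤ r / R * R := by gcongr
        _ = r := by field_simp

/-- The weighted size of the optimal solutions. -/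
noncomputable def optRadius {n : ℕ} (c xs ss : E n) (p : ℝ) : ℝ := p * ‖xs‖ + ‖c - ss‖ / p

/-- The constant relating the distance to the optima and the normalized duality gap. -/
noncomputable def errorConst {n : ℕ} (c q xs ss : E n) (μp μd h p : ℝ) : ℝ :=
  h ^ 2 * (1 + ‖ss‖ / (μp * ‖c‖) + ‖xs‖ / (μd * ‖q‖) +
    3 * (p / (μp * ‖c‖) + 1 / (p * (μd * ‖q‖))) * optRadius c xs ss p)

/-- `x - v` is the correction of `x` to `A x = b`. On the support of `ss` the optimum `xs` vanishes,
so there the growth sum is at most `ss i * (x i + |v i|)`. -/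
theorem SharpPair.primal_error_le (D : SharpPair A b c q xs ss ys μp μd) {x v : E n}
    (hx : x ∈ orthant n) (hv : x - v - xs ∈ vecVp A) :
    μp * ‖c‖ * ‖x - v - xs‖ ≤ ⟪ss, x⟫ + ‖ss‖ * ‖v‖ := by
  refine (D.growth_p _ hv).trans ?_
  have h1 : ∑ i, ss i * |(x - v - xs) i| ≤ ∑ i, (ss i * x i + ss i * |v i|) := by
    refine Finset.sum_le_sum fun i _ => ?_
    rcases D.compl i with h | h
    · rw [← mul_add]
      refine mul_le_mul_of_nonneg_left ?_ (D.ss_nonneg i)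
      simp only [PiLp.sub_apply, h, sub_zero]
      refine (abs_sub _ _).trans ?_
      rw [abs_of_nonneg (hx i)]
    · simp [h]
  refine h1.trans ?_
  rw [Finset.sum_add_distrib, ← inner_eq_sum]
  linarith [sum_mul_abs_le ss v]

/-- Uses `|s i| = s i + 2 * max (-s i) 0` on the support of `xs`. One copy of the negative part
stays with `⟪xs, s⟫` to form a nonnegative quantity; the other is bounded by Cauchy–Schwarz. -/
theorem SharpPair.dual_error_le (D : SharpPair A b c q xs ss ys μp μd) {s : E n}
    (hs : s - ss ∈ (vecVp A)ᗮ) :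
    μd * ‖q‖ * ‖s - ss‖ ≤ ⟪xs, s⟫ + ⟪xs, posPart (-s)⟫ + ‖xs‖ * ‖posPart (-s)‖ := by
  refine (D.growth_d _ hs).trans ?_
  have h1 : ∑ i, xs i * |(s - ss) i| ≤
      ∑ i, (xs i * s i + xs i * posPart (-s) i + xs i * posPart (-s) i) := by
    refine Finset.sum_le_sum fun i _ => ?_
    rcases D.compl i with h | h
    · simp [h]
    · rw [← mul_add, ← mul_add]
      refine mul_le_mul_of_nonneg_left ?_ (D.xs_nonneg i)
      change |s i - ss i| ≤ s i + max (-s i) 0 + max (-s i) 0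
      rw [h, sub_zero]
      rcases le_total (s i) 0 with h' | h'
      · rw [max_eq_left (by linarith), abs_of_nonpos h']; linarith
      · rw [max_eq_right (by linarith), abs_of_nonneg h']; linarith
  refine h1.trans ?_
  rw [Finset.sum_add_distrib, Finset.sum_add_distrib, ← inner_eq_sum, ← inner_eq_sum]
  linarith [real_inner_le_norm xs (posPart (-s))]

/-- Both complementarity products come from the duality gap, up to a term in the infeasibility `v`.
-/
theorem SharpPair.gap_eq (D : SharpPair A b c q xs ss ys μp μd) {x v : E n} {y : E m}
    (hv : app A v = app A x - b) :
    ⟪ss, x⟫ + ⟪xs, c - appT A y⟫ = ⟪c, x⟫ - ⟪b, y⟫ - ⟪c - ss, v⟫ := by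
  have h1 : ⟪c - ss, v⟫ = ⟪ys, app A x - b⟫ := by
    rw [← D.appT_ys, real_inner_comm, ← inner_app_left, hv, real_inner_comm]
  have h2 : ⟪ys, app A x⟫ = ⟪c, x⟫ - ⟪ss, x⟫ := by
    rw [real_inner_comm, inner_app_left, D.appT_ys, real_inner_comm, inner_sub_left]
  have h3 : ⟪xs, appT A y⟫ = ⟪b, y⟫ := by rw [← inner_app_left, D.app_xs]
  rw [h1, inner_sub_right, inner_sub_right, h2, h3, real_inner_comm b ys, D.inner_b_ys,
    real_inner_comm xs c]
  ring

/-- The error bound behind linear convergence: the gap bounds residuals and complementarity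
products, and the growth inequalities bound the distance by these. -/
theorem SharpPair.normM_sub_le (D : SharpPair A b c q xs ss ys μp μd) (hst : IsStepSize A τ σ)
    (hw : IsWeight A τ σ h p) {z : E n × E m} (hz : z.1 ∈ orthant n)
    (hz2 : z.2 ∈ LinearMap.range (app A)) {r ρ : ℝ} (hr : 0 < r)
    (hrR : r ≤ 2 * (h * optRadius c xs ss p)) (hzR : normM A τ σ z ≤ 2 * (h * optRadius c xs ss p))
    (hgap : ∀ z' : E n × E m, z'.1 ∈ orthant n → normM A τ σ (z' - z) ≤ r →
      saddleGap A b c z z' ≤ r * ρ) :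
    normM A τ σ (z - (xs, ys)) ≤ errorConst c q xs ss μp μd h p * ρ := by
  obtain ⟨x, y⟩ := z
  simp only at hz hz2
  have hp := hw.p_pos
  have hh := hw.h_pos
  have hl := lamMin_pos A D.app_ne
  have hc : 0 < μp * ‖c‖ := mul_pos D.mup_pos (norm_pos_iff.2 D.c_ne)
  have hq : 0 < μd * ‖q‖ := mul_pos D.mud_pos (norm_pos_iff.2 D.q_ne)
  obtain ⟨h1, h2, h3⟩ := residuals_le_of_saddleGap_le hst hz hr hrR hzR hgap
  simp only at h1 h2 h3
  obtain ⟨v, hv, hve⟩ := exists_mem_orthogonal_app_eq A (x - xs)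
  rw [map_sub, D.app_xs] at hve
  set P := optRadius c xs ss p with hP
  set s := c - appT A y with hs
  set dd := ‖posPart (-s)‖ with hdd
  have hvn : ‖v‖ ≤ h * ρ / p := by
    have h4 := lamMin_mul_norm_le A hv hl.le
    rw [hve, norm_sub_rev] at h4
    rw [hw.sqrt_sigma, div_mul_eq_mul_div, div_le_iff₀ (by positivity)] at h1
    rw [le_div_iff₀ hp]
    have h5 : lamMin A * (‖v‖ * p) ≤ lamMin A * (h * ρ) := by nlinarith
    exact le_of_mul_le_mul_left h5 hl
  have hddn : dd ≤ h * p * ρ := by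
    rw [hw.sqrt_tau, div_mul_eq_mul_div, div_le_iff₀ (by positivity)] at h2
    linarith
  have hmem : x - v - xs ∈ vecVp A := by
    rw [vecVp, LinearMap.mem_ker, map_sub, map_sub, hve, D.app_xs]
    abel
  have hpe := D.primal_error_le hz hmem
  have hss : s - ss = appT A (ys - y) := by
    rw [map_sub, D.appT_ys, hs]; abel
  have hde := D.dual_error_le (s := s) (by rw [hss]; exact appT_mem_orthogonal A _)
  have hg := D.gap_eq (y := y) hve
  rw [← hs] at hg
  set a := ⟪ss, x⟫ with ha
  set a' := ⟪xs, s⟫ + ⟪xs, posPart (-s)⟫ with ha'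
  have ha0 : 0 ≤ a := by
    rw [ha, inner_eq_sum]
    exact Finset.sum_nonneg fun i _ => mul_nonneg (D.ss_nonneg i) (hz i)
  have ha0' : 0 ≤ a' := by
    rw [ha', inner_eq_sum, inner_eq_sum, ← Finset.sum_add_distrib]
    refine Finset.sum_nonneg fun i _ => ?_
    rw [← mul_add]
    refine mul_nonneg (D.xs_nonneg i) ?_
    change 0 ≤ s i + max (-s i) 0
    linarith [le_max_left (-s i) 0]
  -- The constant `3`: the duality gap over radius `2 h P` contributes `2`, and the two
  -- infeasibility terms together contribute `1`.
  have haa : a + a' ≤ 3 * (h * P * ρ) := by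
    have e1 : -⟪c - ss, v⟫ ≤ ‖c - ss‖ * (h * ρ / p) := by
      refine (neg_le_abs _).trans ((abs_real_inner_le_norm _ _).trans ?_)
      gcongr
    have e2 : ⟪xs, posPart (-s)⟫ ≤ ‖xs‖ * (h * p * ρ) :=
      (real_inner_le_norm _ _).trans (by gcongr)
    have e3 : ‖c - ss‖ * (h * ρ / p) + ‖xs‖ * (h * p * ρ) = h * P * ρ := by
      rw [hP, optRadius]; field_simp; ring
    linarith
  have hxe : p * ‖x - xs‖ ≤ h * ρ + p / (μp * ‖c‖) * a + ‖ss‖ / (μp * ‖c‖) * (h * ρ) := by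
    have e1 : ‖x - xs‖ ≤ ‖v‖ + ‖x - v - xs‖ := by
      have : x - xs = v + (x - v - xs) := by abel
      conv_lhs => rw [this]
      exact norm_add_le _ _
    have e2 : ‖x - v - xs‖ ≤ (a + ‖ss‖ * ‖v‖) / (μp * ‖c‖) := by
      rw [le_div_iff₀ hc]; linarith
    calc p * ‖x - xs‖ ≤ p * (‖v‖ + (a + ‖ss‖ * ‖v‖) / (μp * ‖c‖)) := by
          gcongr; linarith
      _ ≤ p * (h * ρ / p + (a + ‖ss‖ * (h * ρ / p)) / (μp * ‖c‖)) := by gcongr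
      _ = _ := by field_simp; ring
  have hse : ‖s - ss‖ / p ≤ 1 / (p * (μd * ‖q‖)) * a' + ‖xs‖ / (μd * ‖q‖) * (h * ρ) := by
    have e2 : ‖s - ss‖ ≤ (a' + ‖xs‖ * dd) / (μd * ‖q‖) := by
      rw [le_div_iff₀ hq]; linarith
    calc ‖s - ss‖ / p ≤ (a' + ‖xs‖ * (h * p * ρ)) / (μd * ‖q‖) / p := by
          gcongr; refine e2.trans ?_; gcongr
      _ = _ := by field_simp
  have hN : normM A τ σ ((x, y) - (xs, ys)) ≤ h * (p * ‖x - xs‖ + ‖s - ss‖ / p) := by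
    have := hw.normM_le hst D.app_ne (z := (x, y) - (xs, ys)) (sub_mem hz2 D.ys_mem)
    refine this.trans_eq ?_
    simp only [Prod.fst_sub, Prod.snd_sub]
    rw [hss, map_sub, map_sub, norm_sub_rev (appT A ys)]
  set U := p / (μp * ‖c‖) with hU
  set U' := 1 / (p * (μd * ‖q‖)) with hU'
  have hU0 : 0 ≤ U := by positivity
  have hU0' : 0 ≤ U' := by positivity
  have hmix : U * a + U' * a' ≤ (U + U') * (3 * (h * P * ρ)) := by
    calc U * a + U' * a' ≤ (U + U') * (a + a') := by
          nlinarith [mul_nonneg hU0 ha0', mul_nonneg hU0' ha0]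
      _ ≤ _ := by gcongr
  refine hN.trans ?_
  rw [errorConst]
  calc h * (p * ‖x - xs‖ + ‖s - ss‖ / p)
      ≤ h * (h * ρ + ‖ss‖ / (μp * ‖c‖) * (h * ρ) + ‖xs‖ / (μd * ‖q‖) * (h * ρ) +
        (U + U') * (3 * (h * P * ρ))) := by
        refine mul_le_mul_of_nonneg_left ?_ hh.le; linarith
    _ = _ := by ring

end Error

/-! ### Complexity of restarted PDHG for a sharp pair -/

section Complexity

variable {m n : ℕ} {A : Matrix (Fin m) (Fin n) ℝ} {b : E m} {c q xs ss : E n} {ys : E m}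
  {μp μd τ σ h p : ℝ}

theorem SharpPair.xs_ne (D : SharpPair A b c q xs ss ys μp μd) : xs ≠ 0 := by
  intro h0
  have hb : app A q = 0 := by rw [D.app_q, ← D.app_xs, h0, map_zero]
  have h1 : ⟪q, q⟫ = 0 := D.q_mem q (LinearMap.mem_ker.2 hb)
  exact D.q_ne (inner_self_eq_zero.1 h1)

theorem SharpPair.optRadius_pos (D : SharpPair A b c q xs ss ys μp μd) (hp : 0 < p) :
    0 < optRadius c xs ss p := by
  have := norm_pos_iff.2 D.xs_ne
  rw [optRadius]
  positivity

theorem SharpPair.errorConst_ge (D : SharpPair A b c q xs ss ys μp μd) (hp : 0 < p) :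
    h ^ 2 ≤ errorConst c q xs ss μp μd h p := by
  have h1 := D.optRadius_pos hp
  have h2 := D.mup_pos
  have h3 := D.mud_pos
  rw [errorConst]
  refine le_mul_of_one_le_right (sq_nonneg h) ?_
  have e1 : 0 ≤ ‖ss‖ / (μp * ‖c‖) := by positivity
  have e2 : 0 ≤ ‖xs‖ / (μd * ‖q‖) := by positivity
  have e3 : 0 ≤ 3 * (p / (μp * ‖c‖) + 1 / (p * (μd * ‖q‖))) * optRadius c xs ss p := by positivity
  linarith

theorem SharpPair.normM_optimal_le (D : SharpPair A b c q xs ss ys μp μd)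
    (hst : IsStepSize A τ σ) (hw : IsWeight A τ σ h p) :
    normM A τ σ (xs, ys) ≤ h * optRadius c xs ss p := by
  have h1 := hw.normM_le hst D.app_ne (z := (xs, ys)) D.ys_mem
  simp only [D.appT_ys] at h1
  exact h1

theorem SharpPair.normM_pdhgAverage_sub_le_gap (D : SharpPair A b c q xs ss ys μp μd)
    (hst : IsStepSize A τ σ) (hw : IsWeight A τ σ h p) {z : E n × E m}
    (hz2 : z.2 ∈ LinearMap.range (app A))
    (hzR : normM A τ σ (z - (xs, ys)) ≤ h * optRadius c xs ss p) {k : ℕ} (hk : 1 ≤ k) :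
    normM A τ σ (pdhgAverage A b c τ σ z k - (xs, ys)) ≤ errorConst c q xs ss μp μd h p *
      normalizedGap A b c τ σ (normM A τ σ (pdhgAverage A b c τ σ z k - z))
        (pdhgAverage A b c τ σ z k) := by
  have hb : b ∈ LinearMap.range (app A) := ⟨xs, D.app_xs⟩
  set w := pdhgAverage A b c τ σ z k with hwdef
  set R := h * optRadius c xs ss p with hR
  have hR0 : 0 < R := mul_pos hw.h_pos (D.optRadius_pos hw.p_pos)
  have hw1 : w.1 ∈ orthant n := pdhgAverage_fst_mem z k
  have hw2 : w.2 ∈ LinearMap.range (app A) := pdhgAverage_snd_mem hb hz2 k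
  have hwR : normM A τ σ (w - (xs, ys)) ≤ R :=
    (normM_pdhgAverage_sub_le hst D.isSaddle z hk).trans hzR
  have h0R : normM A τ σ (xs, ys) ≤ R := D.normM_optimal_le hst hw
  have hwn : normM A τ σ w ≤ 2 * R := by
    have := hst.normM_add_le (w - (xs, ys)) (xs, ys)
    rw [sub_add_cancel] at this
    linarith
  have hr2 : normM A τ σ (w - z) ≤ 2 * R := by
    have := hst.normM_sub_le w z (xs, ys)
    rw [hst.normM_sub_rev (xs, ys) z] at this
    linarith
  rcases (normM_nonneg (A := A) (τ := τ) (σ := σ) (w - z)).eq_or_lt with h0 | h0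
  -- If the average has not moved, the normalized gap is `0` by convention, so optimality must be
  -- proved: the gap on every ball of small radius `r` is at most `r * (2 r / k)`, and letting `r`
  -- tend to `0` makes the distance vanish.
  · have hk0 : (0 : ℝ) < k := by positivity
    set K := errorConst c q xs ss μp μd h p with hK
    have hK0 : 0 < K := (pow_pos hw.h_pos 2).trans_le (D.errorConst_ge hw.p_pos)
    have hsmall : ∀ r : ℝ, 0 < r → r ≤ 2 * R → normM A τ σ (w - (xs, ys)) ≤ K * (2 * r / k) := by
      intro r hr hrR
      refine D.normM_sub_le hst hw hw1 hw2 hr hrR hwn fun z' hz' hz'r => ?_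
      refine (saddleGap_average_le_of_normM_le hst z hk (h0.symm.le.trans hr.le) hz' hz'r).trans_eq
        ?_
      ring
    have hlim : normM A τ σ (w - (xs, ys)) ≤ 0 := by
      by_contra hpos
      push Not at hpos
      set d := normM A τ σ (w - (xs, ys)) with hd
      have h1 : 0 < d * k / (4 * K) := by positivity
      have h2 := hsmall (min (2 * R) (d * k / (4 * K))) (lt_min (by linarith) h1) (min_le_left _ _)
      have h3 : K * (2 * min (2 * R) (d * k / (4 * K)) / k) ≤ K * (2 * (d * k / (4 * K)) / k) := by
        gcongr; exact min_le_right _ _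
      have h4 : K * (2 * (d * k / (4 * K)) / k) = d / 2 := by field_simp; ring
      linarith
    rw [← h0]
    simpa [normalizedGap] using hlim
  · exact D.normM_sub_le hst hw hw1 hw2 h0 hr2 hwn fun z' hz' hz'r =>
      saddleGap_le_mul_normalizedGap hst z hk h0 hz' hz'r

theorem normalizedGap_average_le_dist (hst : IsStepSize A τ σ) {w : E n × E m}
    (hw : IsSaddle A b c w) (z : E n × E m) {k : ℕ} (hk : 1 ≤ k) :
    normalizedGap A b c τ σ (normM A τ σ (pdhgAverage A b c τ σ z k - z))
      (pdhgAverage A b c τ σ z k) ≤ 4 * normM A τ σ (z - w) / k := by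
  have hk0 : (0 : ℝ) < k := by positivity
  refine (normalizedGap_average_le hst z hk).trans ?_
  have h1 := hst.normM_sub_le (pdhgAverage A b c τ σ z k) z w
  rw [hst.normM_sub_rev w z] at h1
  have h2 := normM_pdhgAverage_sub_le hst hw z hk
  refine div_le_div_of_nonneg_right ?_ hk0.le
  linarith

/-- The gap after `k` steps is at most `4 dist / k ≤ 4 K ρ / k`, so `k = ⌈4 e K⌉` already meets the
restart condition. The radius `R` bounds the distance at every restart, since distances to the
saddle point never grow. The forced restart at `k = 1` accounts for the isolated `1` in the count.
-/
theorem SharpPair.exists_reaches (D : SharpPair A b c q xs ss ys μp μd)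
    (hst : IsStepSize A τ σ) (hw : IsWeight A τ σ h p) (N : ℕ) :
    ∃ (T : ℕ) (zprev z : E n × E m), Reaches A b c τ σ (1 / Real.exp 1) (N + 1) T zprev z ∧
      (T : ℝ) ≤ 1 + N * (4 * Real.exp 1 * errorConst c q xs ss μp μd h p + 1) ∧
      z.2 ∈ LinearMap.range (app A) ∧
      normM A τ σ (z - (xs, ys)) ≤ h * optRadius c xs ss p ∧
      normM A τ σ (z - (xs, ys)) ≤ errorConst c q xs ss μp μd h p *
        normalizedGap A b c τ σ (normM A τ σ (z - zprev)) z ∧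
      normalizedGap A b c τ σ (normM A τ σ (z - zprev)) z ≤
        4 * (h * optRadius c xs ss p) * Real.exp (-N) := by
  have hb : b ∈ LinearMap.range (app A) := ⟨xs, D.app_xs⟩
  set K := errorConst c q xs ss μp μd h p with hK
  have hK0 : 0 < K := (pow_pos hw.h_pos 2).trans_le (D.errorConst_ge hw.p_pos)
  set R := h * optRadius c xs ss p with hR
  induction N with
  | zero =>
    have h0 : ((0 : E n × E m)).2 ∈ LinearMap.range (app A) := zero_mem _
    have h0R : normM A τ σ (0 - (xs, ys)) ≤ R := by
      rw [hst.normM_sub_rev, sub_zero]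
      exact D.normM_optimal_le hst hw
    refine ⟨0 + 1, 0, pdhgAverage A b c τ σ 0 1, Reaches.restart 0 0 1 0 0 Reaches.start
      ⟨⟨le_rfl, Or.inl ⟨rfl, rfl⟩⟩, fun j hj => hj.1⟩, by simp, pdhgAverage_snd_mem hb h0 1,
      (normM_pdhgAverage_sub_le hst D.isSaddle 0 le_rfl).trans h0R,
      D.normM_pdhgAverage_sub_le_gap hst hw h0 h0R le_rfl, ?_⟩
    refine (normalizedGap_average_le_dist hst D.isSaddle 0 le_rfl).trans ?_
    simp only [Nat.cast_one, div_one, Nat.cast_zero, neg_zero, Real.exp_zero, mul_one]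
    linarith
  | succ N ih =>
    obtain ⟨T, zprev, z, hreach, hT, hz2, hzR, hzK, hgap⟩ := ih
    set ρ := normalizedGap A b c τ σ (normM A τ σ (z - zprev)) z with hρ
    have hρ0 : 0 ≤ ρ := nonneg_of_mul_nonneg_right ((normM_nonneg _).trans hzK) hK0
    have he : 0 < Real.exp 1 := Real.exp_pos 1
    set j := ⌈4 * Real.exp 1 * K⌉₊ with hj
    have hj1 : 1 ≤ j := Nat.one_le_iff_ne_zero.2 (Nat.ceil_pos.2 (by positivity)).ne'
    have hj0 : (0 : ℝ) < j := by positivity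
    have hjmem : j ∈ {j : ℕ | 1 ≤ j ∧
        RestartCondition A b c τ σ (1 / Real.exp 1) (N + 1) zprev z j} := by
      refine ⟨hj1, Or.inr ⟨Nat.succ_ne_zero N, ?_⟩⟩
      refine (normalizedGap_average_le_dist hst D.isSaddle z hj1).trans ?_
      rw [div_le_iff₀ hj0]
      have hjle : 4 * Real.exp 1 * K ≤ j := Nat.le_ceil _
      calc 4 * normM A τ σ (z - (xs, ys)) ≤ 4 * (K * ρ) := by gcongr
        _ = 1 / Real.exp 1 * ρ * (4 * Real.exp 1 * K) := by field_simp
        _ ≤ _ := by gcongr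
    classical
    obtain ⟨k, hk⟩ : ∃ k, IsLeast {j : ℕ | 1 ≤ j ∧
        RestartCondition A b c τ σ (1 / Real.exp 1) (N + 1) zprev z j} k :=
      ⟨_, Nat.isLeast_find ⟨j, hjmem⟩⟩
    have hk1 : 1 ≤ k := hk.1.1
    have hkj : (k : ℝ) ≤ 4 * Real.exp 1 * K + 1 :=
      (Nat.cast_le.2 (hk.2 hjmem)).trans (Nat.ceil_lt_add_one (by positivity)).le
    refine ⟨T + k, z, pdhgAverage A b c τ σ z k, Reaches.restart (N + 1) T k zprev z hreach hk, ?_,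
      pdhgAverage_snd_mem hb hz2 k, (normM_pdhgAverage_sub_le hst D.isSaddle z hk1).trans hzR,
      D.normM_pdhgAverage_sub_le_gap hst hw hz2 hzR hk1, ?_⟩
    · push_cast
      linarith
    · rcases hk.1.2 with hc | hc
      · exact absurd hc.1 (Nat.succ_ne_zero N)
      refine hc.2.trans ?_
      have hexp : Real.exp (-((N + 1 : ℕ) : ℝ)) = 1 / Real.exp 1 * Real.exp (-N) := by
        rw [one_div, ← Real.exp_neg, ← Real.exp_add]
        push_cast
        ring_nf
      rw [hexp]
      calc 1 / Real.exp 1 * ρ ≤ 1 / Real.exp 1 * (4 * R * Real.exp (-N)) := by gcongr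
        _ = _ := by ring

theorem errD_eq (hX : Xopt A b c = {xs}) (hS : Sopt A c q = {ss}) (x s : E n) :
    errD A b c q x s = max ‖x - xs‖ ‖s - ss‖ := by
  rw [errD, hX, hS, Metric.infDist_singleton, Metric.infDist_singleton, dist_eq_norm, dist_eq_norm]

theorem SharpPair.errD_le (D : SharpPair A b c q xs ss ys μp μd)
    (hst : IsStepSize A τ σ) (hw : IsWeight A τ σ h p) (hX : Xopt A b c = {xs})
    (hS : Sopt A c q = {ss}) (z : E n × E m) :
    errD A b c q z.1 (c - appT A z.2) ≤
      2 / h * max (1 / p) (kappa A * p) * normM A τ σ (z - (xs, ys)) := by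
  have hp := hw.p_pos
  have hh := hw.h_pos
  have hl := lamMin_pos A D.app_ne
  have hN := normM_nonneg (A := A) (τ := τ) (σ := σ) (z - (xs, ys))
  rw [errD_eq hX hS]
  refine max_le ?_ ?_
  · have h1 := hst.norm_fst_le (z - (xs, ys))
    rw [hw.sqrt_tau] at h1
    refine h1.trans ?_
    calc 2 * (1 / (h * p)) * normM A τ σ (z - (xs, ys))
        = 2 / h * (1 / p) * normM A τ σ (z - (xs, ys)) := by field_simp
      _ ≤ _ := by gcongr; exact le_max_left _ _
  · have h1 := hst.norm_snd_le (z - (xs, ys))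
    rw [hw.sqrt_sigma] at h1
    have h2 : c - appT A z.2 - ss = -appT A (z - (xs, ys)).2 := by
      rw [Prod.snd_sub, map_sub, D.appT_ys]; abel
    rw [h2, norm_neg]
    refine (norm_appT_le A _).trans ?_
    calc lamMax A * ‖(z - (xs, ys)).2‖
        ≤ lamMax A * (2 * (p / (h * lamMin A)) * normM A τ σ (z - (xs, ys))) := by
          gcongr; exact lamMax_nonneg A
      _ = 2 / h * (kappa A * p) * normM A τ σ (z - (xs, ys)) := by rw [kappa]; field_simp
      _ ≤ _ := by gcongr; exact le_max_right _ _

/-- The iteration bound for restarted PDHG, for every constant `L` above `errorConst`. -/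
theorem SharpPair.exists_isIterationCount (D : SharpPair A b c q xs ss ys μp μd)
    (hst : IsStepSize A τ σ) (hw : IsWeight A τ σ h p) (hX : Xopt A b c = {xs})
    (hS : Sopt A c q = {ss}) {L : ℝ} (hL : errorConst c q xs ss μp μd h p ≤ L) {ε : ℝ}
    (hε : 0 < ε) (hεE : ε ≤ errD A b c q 0 c) :
    ∃ T : ℕ, IsIterationCount A b c q τ σ (1 / Real.exp 1) ε T ∧
      (T : ℝ) ≤ iterationBound L (kappa A) (p ^ 2) (errD A b c q 0 c) ε := by
  have hp := hw.p_pos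
  have hh := hw.h_pos
  have hl := lamMin_pos A D.app_ne
  have hκ : 1 ≤ kappa A := (one_le_div hl).2 (lamMin_le_lamMax A D.app_ne)
  have hh2 : h ^ 2 = 2 * kappa A := by
    rw [kappa, ← mul_div_assoc, eq_div_iff hl.ne']; exact hw.h_sq
  have he : 1 ≤ Real.exp 1 := Real.one_le_exp zero_le_one
  set K := errorConst c q xs ss μp μd h p with hK
  have hK2 : 2 ≤ K := by
    have := D.errorConst_ge (h := h) hp
    linarith
  set E₀ := errD A b c q 0 c with hE₀
  have hE0 : 0 < E₀ := hε.trans_le hεE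
  have hEx : ‖xs‖ ≤ E₀ := by
    rw [hE₀, errD_eq hX hS, zero_sub, norm_neg]; exact le_max_left _ _
  have hEs : ‖c - ss‖ ≤ E₀ := by
    rw [hE₀, errD_eq hX hS]; exact le_max_right _ _
  set F := (1 + kappa A * p ^ 2) * (1 + 1 / p ^ 2) with hF
  have hF1 : 1 ≤ F := by
    refine one_le_mul_of_one_le_of_one_le ?_ ?_ <;> simp <;> positivity
  set Y := 16 * Real.exp 1 * L * (E₀ / ε) * (1 + kappa A * p ^ 2) * (1 + 1 / p ^ 2) with hY
  have hYF : Y = 16 * Real.exp 1 * L * (E₀ / ε) * F := by rw [hY, hF]; ring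
  have hE1 : 1 ≤ E₀ / ε := (one_le_div hε).2 hεE
  have hY1 : 1 ≤ Y := by
    rw [hYF]
    refine one_le_mul_of_one_le_of_one_le (one_le_mul_of_one_le_of_one_le ?_ hE1) hF1
    refine one_le_mul_of_one_le_of_one_le ?_ (by linarith)
    linarith
  have hY0 : 0 < Y := by linarith
  have hlog : 0 ≤ Real.log Y := Real.log_nonneg hY1
  -- After `⌊log Y⌋ + 1` outer iterations the decay factor is at most `e / Y`; the `16 e` inside `Y`
  -- cancels this `e` and the constant `8 = 2 · 4` of the error bound, leaving `ε / 2`.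
  obtain ⟨T, zprev, z, hreach, hT, hz2, -, hzK, hgap⟩ := D.exists_reaches hst hw ⌊Real.log Y⌋₊
  rw [← hK] at hT hzK
  have hexp : Real.exp (-(⌊Real.log Y⌋₊ : ℝ)) ≤ Real.exp 1 / Y := by
    rw [le_div_iff₀ hY0]
    nth_rewrite 2 [← Real.exp_log hY0]
    rw [← Real.exp_add]
    refine Real.exp_le_exp.2 ?_
    linarith [Nat.lt_floor_add_one (Real.log Y)]
  have hP : optRadius c xs ss p ≤ E₀ * (p + 1 / p) := by
    rw [optRadius]
    calc p * ‖xs‖ + ‖c - ss‖ / p ≤ p * E₀ + E₀ / p := by gcongr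
      _ = _ := by ring
  have hmax : (p + 1 / p) * max (1 / p) (kappa A * p) ≤ F := by
    rw [mul_max_of_nonneg _ _ (by positivity)]
    have hFe : F = 1 + 1 / p ^ 2 + kappa A * p ^ 2 + kappa A := by rw [hF]; field_simp; ring
    refine max_le ?_ ?_
    · have : (p + 1 / p) * (1 / p) = 1 + 1 / p ^ 2 := by field_simp
      rw [this, hFe]
      have : 0 ≤ kappa A * p ^ 2 := by positivity
      linarith
    · have : (p + 1 / p) * (kappa A * p) = kappa A * p ^ 2 + kappa A := by field_simp
      rw [this, hFe]
      have : 0 ≤ 1 / p ^ 2 := by positivity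
      linarith
  have herr : errD A b c q z.1 (c - appT A z.2) ≤ ε := by
    refine (D.errD_le hst hw hX hS z).trans ?_
    calc 2 / h * max (1 / p) (kappa A * p) * normM A τ σ (z - (xs, ys))
        ≤ 2 / h * max (1 / p) (kappa A * p) *
          (K * (4 * (h * (E₀ * (p + 1 / p))) * (Real.exp 1 / Y))) := by
          have hm0 : 0 ≤ max (1 / p) (kappa A * p) := le_max_of_le_left (by positivity)
          refine mul_le_mul_of_nonneg_left (hzK.trans ?_) (by positivity)
          refine mul_le_mul_of_nonneg_left (hgap.trans ?_) (by linarith)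
          gcongr
      _ = 8 * K * E₀ * ((p + 1 / p) * max (1 / p) (kappa A * p)) * (Real.exp 1 / Y) := by
          field_simp; ring
      _ ≤ 8 * L * E₀ * F * (Real.exp 1 / Y) := by
          have hm0 : 0 ≤ (p + 1 / p) * max (1 / p) (kappa A * p) :=
            mul_nonneg (by positivity) (le_max_of_le_left (by positivity))
          have hK0 : 0 ≤ K := by linarith
          have hL0 : 0 ≤ L := by linarith
          gcongr
      _ = ε / 2 := by
          have hL0 : L ≠ 0 := by linarith
          have hF0 : F ≠ 0 := by linarith
          rw [hYF]; field_simp; ring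
      _ ≤ ε := by linarith
  classical
  have hmem : T ∈ {T' : ℕ | ∃ (N : ℕ) (zprev z : E n × E m),
      Reaches A b c τ σ (1 / Real.exp 1) N T' zprev z ∧
      errD A b c q z.1 (c - appT A z.2) ≤ ε} := ⟨_, zprev, z, hreach, herr⟩
  obtain ⟨T₀, hT₀⟩ : ∃ T₀, IsIterationCount A b c q τ σ (1 / Real.exp 1) ε T₀ :=
    ⟨_, Nat.isLeast_find ⟨T, hmem⟩⟩
  refine ⟨T₀, hT₀, ?_⟩
  have hTT : (T₀ : ℝ) ≤ T := Nat.cast_le.2 (hT₀.2 hmem)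
  rw [iterationBound, ← hY]
  have hfl : (⌊Real.log Y⌋₊ : ℝ) ≤ Real.log Y := Nat.floor_le hlog
  -- The constant `9` leaves `5 e L ≥ 1` to absorb the rounding up in each outer iteration.
  have hco : 4 * Real.exp 1 * K + 1 ≤ 9 * Real.exp 1 * L := by
    have h1 : 4 * Real.exp 1 * K ≤ 4 * Real.exp 1 * L := by gcongr
    have h2 : 1 ≤ 5 * Real.exp 1 * L := by nlinarith
    linarith
  calc (T₀ : ℝ) ≤ 1 + ⌊Real.log Y⌋₊ * (4 * Real.exp 1 * K + 1) := hTT.trans hT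
    _ ≤ 1 + Real.log Y * (9 * Real.exp 1 * L) := by
        have : 0 ≤ 4 * Real.exp 1 * K + 1 := by positivity
        gcongr
    _ = _ := by ring

/-- The step-sizes used by restarted PDHG, in terms of their ratio `ω`. -/
theorem isStepSize_isWeight (hA : app A ≠ 0) {ω : ℝ} (hω : 0 < ω)
    (hτ : τ = 1 / (2 * kappa A * ω)) (hσ : σ = ω / (2 * lamMax A * lamMin A)) :
    IsStepSize A τ σ ∧ IsWeight A τ σ √(2 * kappa A) √ω := by
  have hl := lamMin_pos A hA
  have hL := hl.trans_le (lamMin_le_lamMax A hA)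
  have hκ : 0 < kappa A := div_pos hL hl
  have hh : 0 < √(2 * kappa A) := Real.sqrt_pos.2 (by positivity)
  have hp : 0 < √ω := Real.sqrt_pos.2 hω
  have hh2 : √(2 * kappa A) ^ 2 = 2 * kappa A := Real.sq_sqrt (by positivity)
  have hp2 : √ω ^ 2 = ω := Real.sq_sqrt hω.le
  have h1 : √τ = 1 / (√(2 * kappa A) * √ω) := by
    rw [hτ, Real.sqrt_div zero_le_one, Real.sqrt_one, Real.sqrt_mul (by positivity)]
  have hsq : √(2 * kappa A) ^ 2 * lamMin A = 2 * lamMax A := by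
    rw [hh2, kappa]; field_simp
  have h2 : √σ = √ω / (√(2 * kappa A) * lamMin A) := by
    rw [hσ, Real.sqrt_div hω.le]
    congr 1
    rw [Real.sqrt_eq_iff_mul_self_eq (by positivity) (by positivity), ← hsq]
    ring
  have hτ0 : 0 < τ := by rw [hτ]; positivity
  have hσ0 : 0 < σ := by rw [hσ]; positivity
  refine ⟨⟨hτ0, hσ0, ?_⟩, ⟨hh, hp, hsq, h1, h2⟩⟩
  -- The step-size condition holds with equality.
  rw [h1, h2, ← hsq]
  refine le_of_eq ?_
  field_simp

end Complexity

/-! ### The data of the primal-dual pair -/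

section Assembly

variable {m n : ℕ} {A : Matrix (Fin m) (Fin n) ℝ} {b : E m} {c q xs ss : E n}

theorem isTranslate_Vp (A : Matrix (Fin m) (Fin n) ℝ) (b : E m) :
    IsTranslate (Vp A b) (vecVp A) := by
  intro x hx y
  have hx' : app A x = b := hx
  rw [vecVp, LinearMap.mem_ker, map_sub, hx', sub_eq_zero]
  rfl

theorem isTranslate_Vd (A : Matrix (Fin m) (Fin n) ℝ) (c : E n) :
    IsTranslate (Vd A c) (vecVp A)ᗮ := by
  intro x hx y
  have hx' : x - c ∈ (vecVp A)ᗮ := hx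
  change y - c ∈ (vecVp A)ᗮ ↔ _
  rw [← sub_add_sub_cancel y x c]
  exact Submodule.add_mem_iff_left _ hx'

theorem infDist_zero_eq_norm {V : Set (E n)} {W : Submodule ℝ (E n)} (hV : IsTranslate V W)
    {g : E n} (hg : g ∈ V) (hgW : g ∈ Wᗮ) : Metric.infDist 0 V = ‖g‖ := by
  apply le_antisymm
  · simpa using Metric.infDist_le_dist_of_mem (x := (0 : E n)) hg
  · refine (Metric.le_infDist ⟨g, hg⟩).2 fun y hy => ?_
    rw [dist_zero_left]
    have h1 : ⟪y - g, g⟫ = 0 := hgW _ ((hV g hg y).1 hy)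
    have h2 : ‖y‖ ^ 2 = ‖y - g‖ ^ 2 + ‖g‖ ^ 2 := by
      conv_lhs => rw [← sub_add_cancel y g]
      rw [norm_add_sq_real, h1]; ring
    refine le_of_sq_le_sq ?_ (norm_nonneg y)
    rw [h2]; linarith [sq_nonneg ‖y - g‖]

theorem IsLeastNorm.mem_orthogonal (hq : IsLeastNorm A b q) : q ∈ (vecVp A)ᗮ := by
  obtain ⟨v, hv, hve⟩ := exists_mem_orthogonal_app_eq A q
  have hqb : app A q = b := hq.1
  have hw : q - v ∈ vecVp A := by
    rw [vecVp, LinearMap.mem_ker, map_sub, hve, sub_self]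
  have h1 : ⟪q - v, v⟫ = 0 := hv _ hw
  have h2 : ‖q‖ ^ 2 = ‖q - v‖ ^ 2 + ‖v‖ ^ 2 := by
    conv_lhs => rw [← sub_add_cancel q v]
    rw [norm_add_sq_real, h1]; ring
  have h3 : ‖q‖ ≤ ‖v‖ := hq.2 v (hve.trans hqb)
  have h4 : ‖q‖ ^ 2 ≤ ‖v‖ ^ 2 := pow_le_pow_left₀ (norm_nonneg q) h3 2
  have h5 : ‖q - v‖ ^ 2 ≤ 0 := by linarith
  have h6 : q - v = 0 := by
    rw [← norm_eq_zero, ← sq_eq_zero_iff]; exact le_antisymm h5 (sq_nonneg _)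
  rwa [sub_eq_zero.1 h6]

theorem ne_zero_of_nonempty_diff_optimal {g : E n} {V : Set (E n)}
    (h : (feasible V \ optimal g V).Nonempty) : g ≠ 0 := by
  rintro rfl
  obtain ⟨x, hx, hxo⟩ := h
  exact hxo ⟨hx, by simp⟩

/-- The relations between the two unique optimal solutions. -/
structure UniqueOptima {m n : ℕ} (A : Matrix (Fin m) (Fin n) ℝ) (b : E m) (c q xs ss : E n) :
    Prop where
  c_mem : c ∈ vecVp A
  c_ne : c ≠ 0
  q_mem : q ∈ (vecVp A)ᗮ
  q_ne : q ≠ 0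
  app_q : app A q = b
  xs_opt : xs ∈ Xopt A b c
  xs_unique : ∀ x ∈ Xopt A b c, x = xs
  ss_opt : ss ∈ Sopt A c q
  ss_unique : ∀ s ∈ Sopt A c q, s = ss
  nonopt_p : (feasible (Vp A b) \ Xopt A b c).Nonempty
  nonopt_d : (feasible (Vd A c) \ Sopt A c q).Nonempty

theorem UniqueOptima.sub_q_mem (U : UniqueOptima A b c q xs ss) : xs - q ∈ vecVp A :=
  (isTranslate_Vp A b q U.app_q xs).1 U.xs_opt.1.1

/-- As `xs - q ∈ ker A`, the objectives `q` and `xs` differ by a constant on `V_d`, and a point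
complementary to `xs` attains the least possible value `0` of `⟪xs, ·⟫`. -/
theorem UniqueOptima.mem_Sopt (U : UniqueOptima A b c q xs ss) {s : E n}
    (hs : s - c ∈ (vecVp A)ᗮ) (hs0 : s ∈ orthant n) (h : ∀ i, xs i ≠ 0 → s i = 0) :
    s ∈ Sopt A c q := by
  refine ⟨⟨hs, hs0⟩, fun s' hs' => ?_⟩
  have h1 : s' - s ∈ (vecVp A)ᗮ := (isTranslate_Vd A c s hs s').1 hs'.1
  have h2 : ⟪xs - q, s' - s⟫ = 0 := h1 _ U.sub_q_mem
  have h3 : ⟪xs, s⟫ = 0 := by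
    rw [inner_eq_sum]
    refine Finset.sum_eq_zero fun i _ => ?_
    by_cases hi : xs i = 0
    · rw [hi, zero_mul]
    · rw [h i hi, mul_zero]
  have h4 : 0 ≤ ⟪xs, s'⟫ := by
    rw [inner_eq_sum]
    exact Finset.sum_nonneg fun i _ => mul_nonneg (U.xs_opt.1.2 i) (hs'.2 i)
  rw [inner_sub_left, inner_sub_right, inner_sub_right] at h2
  linarith

theorem UniqueOptima.strict (U : UniqueOptima A b c q xs ss) :
    (∀ i, xs i = 0 → 0 < ss i) ∧ ∀ i, xs i ≠ 0 → ss i = 0 := by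
  obtain ⟨s, hs, h1, h2⟩ := exists_strictly_complementary (isTranslate_Vp A b) U.xs_opt U.xs_unique
  have hs0 : s ∈ orthant n := fun i => by
    by_cases hi : xs i = 0
    · exact (h1 i hi).le
    · exact (h2 i hi).ge
  rw [← U.ss_unique s (U.mem_Sopt hs hs0 h2)]
  exact ⟨h1, h2⟩

theorem UniqueOptima.strict_dual (U : UniqueOptima A b c q xs ss) :
    (∀ i, ss i = 0 → 0 < xs i) ∧ ∀ i, ss i ≠ 0 → xs i = 0 := by
  refine ⟨fun i hi => ?_, fun i hi => ?_⟩
  · refine lt_of_le_of_ne (U.xs_opt.1.2 i) fun h => ?_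
    exact (U.strict.1 i h.symm).ne' hi
  · by_contra h
    exact hi (U.strict.2 i h)

/-- Otherwise a small move of `ss` along `w` stays nonnegative, by strict complementarity, and
complementary to `xs`: a second dual optimum. -/
theorem UniqueOptima.determined_dual (U : UniqueOptima A b c q xs ss) :
    ∀ w ∈ (vecVp A)ᗮ, (∀ i, xs i ≠ 0 → w i = 0) → w = 0 := by
  intro w hw hw0
  obtain ⟨δ, hδ, h⟩ := exists_pos_add_mem_orthant U.ss_opt.1.2
  by_contra hne
  have hn : 0 < ‖w‖ := norm_pos_iff.2 hne
  have hopt : ss + (δ / ‖w‖) • w ∈ Sopt A c q := by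
    refine U.mem_Sopt ?_ (h _ ?_ fun i hi => ?_) fun i hi => ?_
    · have := add_mem U.ss_opt.1.1 (Submodule.smul_mem _ (δ / ‖w‖) hw)
      convert this using 1
      abel
    · rw [norm_smul, Real.norm_of_nonneg (by positivity), div_mul_cancel₀ _ hn.ne']
    · have : w i = 0 := hw0 i (U.strict_dual.1 i hi).ne'
      simp [this]
    · simp [hw0 i hi, U.strict.2 i hi]
  have := U.ss_unique _ hopt
  simp [hδ.ne', hne] at this

/-- Such a `w` would be a feasible primal direction with `⟪c, w⟫ = ⟪ss, w⟫ = 0`, against the growth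
of the objective. -/
theorem UniqueOptima.determined_primal (U : UniqueOptima A b c q xs ss) :
    ∀ w ∈ (vecVp A)ᗮᗮ, (∀ i, ss i ≠ 0 → w i = 0) → w = 0 := by
  intro w hw hw0
  rw [Submodule.orthogonal_orthogonal] at hw
  by_contra hne
  have h1 := inner_pos_of_mem_feasibleCone (isTranslate_Vp A b) U.xs_opt U.xs_unique
    (v := w) ⟨hw, fun i hi => (hw0 i (U.strict.1 i hi).ne').ge⟩ hne
  rw [inner_eq_inner_of_sub_mem_orthogonal U.ss_opt.1.1 hw, inner_eq_sum,
    Finset.sum_eq_zero] at h1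
  · exact lt_irrefl _ h1
  · intro i _
    by_cases hi : ss i = 0
    · rw [hi, zero_mul]
    · rw [hw0 i hi, mul_zero]

theorem UniqueOptima.sub_q_mem' (U : UniqueOptima A b c q xs ss) : xs - q ∈ (vecVp A)ᗮᗮ := by
  rw [Submodule.orthogonal_orthogonal]; exact U.sub_q_mem

theorem UniqueOptima.muP_pos (U : UniqueOptima A b c q xs ss) : 0 < muP A b c :=
  sharpness_pos (isTranslate_Vp A b) U.c_mem U.c_ne U.xs_opt U.xs_unique U.nonopt_p

theorem UniqueOptima.muD_pos (U : UniqueOptima A b c q xs ss) : 0 < muD A c q :=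
  sharpness_pos (isTranslate_Vd A c) U.q_mem U.q_ne U.ss_opt U.ss_unique U.nonopt_d

theorem UniqueOptima.muP_le_one (U : UniqueOptima A b c q xs ss) : muP A b c ≤ 1 :=
  sharpness_le_one U.xs_opt U.xs_unique U.nonopt_p

theorem UniqueOptima.muD_le_one (U : UniqueOptima A b c q xs ss) : muD A c q ≤ 1 :=
  sharpness_le_one U.ss_opt U.ss_unique U.nonopt_d

theorem UniqueOptima.infDist_Vp (U : UniqueOptima A b c q xs ss) :
    Metric.infDist 0 (Vp A b) = ‖q‖ :=
  infDist_zero_eq_norm (isTranslate_Vp A b) U.app_q U.q_mem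

theorem UniqueOptima.infDist_Vd (U : UniqueOptima A b c q xs ss) :
    Metric.infDist 0 (Vd A c) = ‖c‖ := by
  refine infDist_zero_eq_norm (isTranslate_Vd A c) (by simp [Vd]) ?_
  rw [Submodule.orthogonal_orthogonal]; exact U.c_mem

theorem UniqueOptima.norm_sub_le (U : UniqueOptima A b c q xs ss) : ‖c - ss‖ ≤ ‖ss‖ := by
  have h1 : ⟪c, ss - c⟫ = 0 := U.ss_opt.1.1 _ U.c_mem
  have h2 : ‖ss‖ ^ 2 = ‖c‖ ^ 2 + ‖ss - c‖ ^ 2 := by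
    conv_lhs => rw [← add_sub_cancel c ss]
    rw [norm_add_sq_real, h1]; ring
  refine le_of_sq_le_sq ?_ (norm_nonneg _)
  rw [norm_sub_rev, h2]; linarith [sq_nonneg ‖c‖]

theorem UniqueOptima.norm_c_le (U : UniqueOptima A b c q xs ss) : ‖c‖ ≤ ‖ss‖ := by
  rw [← U.infDist_Vd]
  simpa using Metric.infDist_le_dist_of_mem (x := (0 : E n)) U.ss_opt.1.1

theorem UniqueOptima.norm_q_le (U : UniqueOptima A b c q xs ss) : ‖q‖ ≤ ‖xs‖ := by
  rw [← U.infDist_Vp]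
  simpa using Metric.infDist_le_dist_of_mem (x := (0 : E n)) U.xs_opt.1.1

theorem UniqueOptima.one_le_p (U : UniqueOptima A b c q xs ss) :
    1 ≤ ‖ss‖ / (muP A b c * ‖c‖) := by
  have := norm_pos_iff.2 U.c_ne
  have := U.muP_pos
  rw [one_le_div (by positivity)]
  nlinarith [U.norm_c_le, U.muP_le_one]

theorem UniqueOptima.one_le_d (U : UniqueOptima A b c q xs ss) :
    1 ≤ ‖xs‖ / (muD A c q * ‖q‖) := by
  have := norm_pos_iff.2 U.q_ne
  have := U.muD_pos
  rw [one_le_div (by positivity)]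
  nlinarith [U.norm_q_le, U.muD_le_one]

theorem UniqueOptima.thetaP_le (U : UniqueOptima A b c q xs ss) :
    thetaP A b c ≤ ‖ss‖ / (muP A b c * ‖c‖) :=
  limitingErrorRatio_le U.muP_pos (isTranslate_Vp A b) U.c_ne U.xs_opt U.xs_unique U.ss_opt.1.1
    U.strict.1 U.strict.2 U.determined_dual (fun _ hv => sharpness_mul_norm_le (isTranslate_Vp A b)
      U.c_mem U.c_ne U.xs_opt U.xs_unique hv) U.one_le_p

theorem UniqueOptima.thetaD_le (U : UniqueOptima A b c q xs ss) :
    thetaD A c q ≤ ‖xs‖ / (muD A c q * ‖q‖) :=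
  limitingErrorRatio_le U.muD_pos (isTranslate_Vd A c) U.q_ne U.ss_opt U.ss_unique U.sub_q_mem'
    U.strict_dual.1 U.strict_dual.2 U.determined_primal
    (fun _ hv => sharpness_mul_norm_le (isTranslate_Vd A c)
      U.q_mem U.q_ne U.ss_opt U.ss_unique hv) U.one_le_d

theorem UniqueOptima.app_ne (U : UniqueOptima A b c q xs ss) : app A ≠ 0 := by
  intro h
  have hq : q ∈ vecVp A := by rw [vecVp, LinearMap.mem_ker, h, LinearMap.zero_apply]
  exact U.q_ne (inner_self_eq_zero.1 (U.q_mem q hq))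

theorem UniqueOptima.exists_sharpPair (U : UniqueOptima A b c q xs ss) :
    ∃ ys, SharpPair A b c q xs ss ys (muP A b c) (muD A c q) := by
  have hmem : c - ss ∈ (vecVp A)ᗮ := by
    rw [← neg_sub]; exact neg_mem U.ss_opt.1.1
  obtain ⟨ys, hys, hye⟩ := exists_appT_eq A hmem
  refine ⟨ys, U.app_ne, U.c_ne, U.q_mem, U.q_ne, U.app_q, U.xs_opt.1.1, U.xs_opt.1.2,
    U.ss_opt.1.1, U.ss_opt.1.2, fun i => ?_, hys, hye, U.muP_pos, U.muD_pos, fun v hv => ?_, fun w hw => ?_⟩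
  · by_cases hi : xs i = 0
    · exact Or.inl hi
    · exact Or.inr (U.strict.2 i hi)
  · exact mul_norm_le_sum_abs U.muP_pos U.c_ne U.ss_opt.1.1 U.strict.2 U.determined_dual
      (fun _ hv => sharpness_mul_norm_le (isTranslate_Vp A b) U.c_mem U.c_ne U.xs_opt
        U.xs_unique hv) hv
  · exact mul_norm_le_sum_abs U.muD_pos U.q_ne U.sub_q_mem' U.strict_dual.2 U.determined_primal
      (fun _ hv => sharpness_mul_norm_le (isTranslate_Vd A c) U.q_mem U.q_ne U.ss_opt
        U.ss_unique hv) hw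

theorem UniqueOptima.Xopt_eq (U : UniqueOptima A b c q xs ss) : Xopt A b c = {xs} :=
  optimal_eq_singleton U.xs_opt U.xs_unique

theorem UniqueOptima.Sopt_eq (U : UniqueOptima A b c q xs ss) : Sopt A c q = {ss} :=
  optimal_eq_singleton U.ss_opt U.ss_unique

/-! ### Comparison of the constants -/

theorem UniqueOptima.relDistP_eq (U : UniqueOptima A b c q xs ss) :
    relDistP A b c = ‖xs‖ / ‖q‖ := by
  rw [relDistP, U.Xopt_eq, U.infDist_Vp, Metric.infDist_singleton, dist_zero_left]

theorem UniqueOptima.relDistD_eq (U : UniqueOptima A b c q xs ss) (v : E n) :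
    relDistD A c q v = ‖v - ss‖ / ‖c‖ := by
  rw [relDistD, U.Sopt_eq, U.infDist_Vd, Metric.infDist_singleton, dist_eq_norm]

theorem UniqueOptima.two_le_sqrt_add_one (U : UniqueOptima A b c q xs ss) : 2 ≤ Real.sqrt n + 1 := by
  have hn : n ≠ 0 := by
    rintro rfl
    exact U.c_ne (Subsingleton.elim _ _)
  have : (1 : ℝ) ≤ √n := Real.one_le_sqrt.2 (by exact_mod_cast Nat.one_le_iff_ne_zero.2 hn)
  linarith

theorem UniqueOptima.kappa_nonneg (U : UniqueOptima A b c q xs ss) : 0 ≤ kappa A :=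
  div_nonneg (lamMax_nonneg A) (lamMin_pos A U.app_ne).le

theorem UniqueOptima.standardL_le (U : UniqueOptima A b c q xs ss) :
    standardL A b c q ≤ standardL' A b c q := by
  have hμp := U.muP_pos
  have hμd := U.muD_pos
  have hc := norm_pos_iff.2 U.c_ne
  have hq := norm_pos_iff.2 U.q_ne
  have hκ := U.kappa_nonneg
  have h1 : ‖xs‖ / ‖q‖ ≤ ‖xs‖ / (muD A c q * ‖q‖) := by
    gcongr; exact mul_le_of_le_one_left hq.le U.muD_le_one
  have h2 : ‖c - ss‖ / ‖c‖ ≤ ‖ss‖ / (muP A b c * ‖c‖) := by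
    gcongr
    · exact U.norm_sub_le
    · exact mul_le_of_le_one_left hc.le U.muP_le_one
  rw [standardL, standardL', U.relDistP_eq, U.relDistD_eq, U.relDistD_eq, zero_sub, norm_neg]
  have e1 : 1 / muP A b c * (‖ss‖ / ‖c‖) = ‖ss‖ / (muP A b c * ‖c‖) := by field_simp
  have e2 : 1 / muD A c q * (‖xs‖ / ‖q‖) = ‖xs‖ / (muD A c q * ‖q‖) := by field_simp
  rw [e1, e2]
  set K := ‖ss‖ / (muP A b c * ‖c‖) + ‖xs‖ / (muD A c q * ‖q‖) with hK
  have hK0 : 0 ≤ K := by positivity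
  calc _ ≤ 8.5 * kappa A * (1 / muP A b c + 1 / muD A c q) * (2 * K) := by
        gcongr
        linarith [U.thetaP_le, U.thetaD_le]
    _ ≤ 8.5 * kappa A * (1 / muP A b c + 1 / muD A c q) * ((√n + 1) * K) := by
        gcongr; exact U.two_le_sqrt_add_one
    _ = _ := by ring

theorem UniqueOptima.optimizedL_le (U : UniqueOptima A b c q xs ss) :
    optimizedL A b c q ≤ optimizedL' A b c q := by
  have hμp := U.muP_pos
  have hμd := U.muD_pos
  have hc := norm_pos_iff.2 U.c_ne
  have hq := norm_pos_iff.2 U.q_ne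
  have hκ := U.kappa_nonneg
  have h1 : ‖xs‖ / ‖q‖ ≤ ‖xs‖ / (muD A c q * ‖q‖) := by
    gcongr; exact mul_le_of_le_one_left hq.le U.muD_le_one
  have h2 : ‖c - ss‖ / ‖c‖ ≤ ‖ss‖ / (muP A b c * ‖c‖) := by
    gcongr
    · exact U.norm_sub_le
    · exact mul_le_of_le_one_left hc.le U.muP_le_one
  rw [optimizedL, optimizedL', U.relDistP_eq, U.relDistD_eq, U.relDistD_eq, zero_sub, norm_neg]
  have e1 : 1 / muP A b c ^ 2 * (‖ss‖ / ‖c‖) = ‖ss‖ / (muP A b c * ‖c‖) / muP A b c := by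
    field_simp
  have e2 : 1 / muD A c q ^ 2 * (‖xs‖ / ‖q‖) = ‖xs‖ / (muD A c q * ‖q‖) / muD A c q := by
    field_simp
  rw [e1, e2]
  set α := ‖ss‖ / (muP A b c * ‖c‖) with hα
  set α' := ‖xs‖ / (muD A c q * ‖q‖) with hα'
  have hK0 : 0 ≤ α / muP A b c + α' / muD A c q := by positivity
  have g1 : thetaP A b c / muP A b c ≤ α / muP A b c := by gcongr; exact U.thetaP_le
  have g2 : thetaD A c q / muD A c q ≤ α' / muD A c q := by gcongr; exact U.thetaD_le
  have g3 : ‖c - ss‖ / ‖c‖ / muP A b c ≤ α / muP A b c := by gcongr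
  have g4 : ‖xs‖ / ‖q‖ / muD A c q ≤ α' / muD A c q := by gcongr
  calc _ ≤ 16 * kappa A * (2 * (α / muP A b c + α' / muD A c q)) := by
        gcongr
        linarith
    _ ≤ 16 * kappa A * ((√n + 1) * (α / muP A b c + α' / muD A c q)) := by
        gcongr; exact U.two_le_sqrt_add_one
    _ = _ := by ring

theorem UniqueOptima.errorConst_le_standardL' (U : UniqueOptima A b c q xs ss) {h p : ℝ}
    (hh : h ^ 2 = 2 * kappa A) (hp0 : 0 < p) (hp : p ^ 2 = ‖c‖ / ‖q‖) :
    errorConst c q xs ss (muP A b c) (muD A c q) h p ≤ standardL' A b c q := by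
  have hμp := U.muP_pos
  have hμd := U.muD_pos
  have hc := norm_pos_iff.2 U.c_ne
  have hq := norm_pos_iff.2 U.q_ne
  have hκ := U.kappa_nonneg
  have h1 : ‖xs‖ / ‖q‖ ≤ ‖xs‖ / (muD A c q * ‖q‖) := by
    gcongr; exact mul_le_of_le_one_left hq.le U.muD_le_one
  have h2 : ‖c - ss‖ / ‖c‖ ≤ ‖ss‖ / (muP A b c * ‖c‖) := by
    gcongr
    · exact U.norm_sub_le
    · exact mul_le_of_le_one_left hc.le U.muP_le_one
  rw [standardL', U.relDistP_eq, U.relDistD_eq, zero_sub, norm_neg, errorConst, hh]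
  have e1 : 1 / muP A b c * (‖ss‖ / ‖c‖) = ‖ss‖ / (muP A b c * ‖c‖) := by field_simp
  have e2 : 1 / muD A c q * (‖xs‖ / ‖q‖) = ‖xs‖ / (muD A c q * ‖q‖) := by field_simp
  rw [e1, e2]
  have hk1 := U.one_le_p
  have hk2 := U.one_le_d
  set α := ‖ss‖ / (muP A b c * ‖c‖) with hα
  set α' := ‖xs‖ / (muD A c q * ‖q‖) with hα'
  set H := 1 / muP A b c + 1 / muD A c q with hH
  have hH2 : 2 ≤ H := by
    have i1 : 1 ≤ 1 / muP A b c := (one_le_div hμp).2 U.muP_le_one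
    have i2 : 1 ≤ 1 / muD A c q := (one_le_div hμd).2 U.muD_le_one
    linarith
  -- With `p² = ‖c‖ / ‖q‖` the weights in the two factors cancel, leaving only relative distances.
  have hprod : (p / (muP A b c * ‖c‖) + 1 / (p * (muD A c q * ‖q‖))) * optRadius c xs ss p =
      H * (‖xs‖ / ‖q‖ + ‖c - ss‖ / ‖c‖) := by
    have hc' : ‖c‖ = p ^ 2 * ‖q‖ := by rw [hp]; field_simp
    rw [optRadius, hH, hc']
    field_simp
  rw [mul_assoc 3, hprod]
  -- The lower-order part `1 + α + α'` is absorbed because `H ≥ 2` and `α, α' ≥ 1`.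
  have hin : 1 + α + α' + 3 * (H * (‖xs‖ / ‖q‖ + ‖c - ss‖ / ‖c‖)) ≤ 4 * (H * (α + α')) := by
    have i1 : H * (‖xs‖ / ‖q‖ + ‖c - ss‖ / ‖c‖) ≤ H * (α + α') := by
      exact mul_le_mul_of_nonneg_left (by linarith) (by linarith)
    nlinarith
  have hHK : 0 ≤ H * (α + α') := by positivity
  calc 2 * kappa A * (1 + α + α' + 3 * (H * (‖xs‖ / ‖q‖ + ‖c - ss‖ / ‖c‖)))
      ≤ 2 * kappa A * (4 * (H * (α + α'))) := by gcongr
    _ ≤ 8.5 * kappa A * (2 * (H * (α + α'))) := by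
        have : 0 ≤ kappa A * (H * (α + α')) := mul_nonneg hκ hHK
        linarith
    _ ≤ 8.5 * kappa A * ((√n + 1) * (H * (α + α'))) := by gcongr; exact U.two_le_sqrt_add_one
    _ = _ := by ring

theorem UniqueOptima.errorConst_le_optimizedL' (U : UniqueOptima A b c q xs ss) {h p : ℝ}
    (hh : h ^ 2 = 2 * kappa A) (hp0 : 0 < p)
    (hp : p ^ 2 = muP A b c * ‖c‖ / (muD A c q * ‖q‖)) :
    errorConst c q xs ss (muP A b c) (muD A c q) h p ≤ optimizedL' A b c q := by
  have hμp := U.muP_pos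
  have hμd := U.muD_pos
  have hc := norm_pos_iff.2 U.c_ne
  have hq := norm_pos_iff.2 U.q_ne
  have hκ := U.kappa_nonneg
  rw [optimizedL', U.relDistP_eq, U.relDistD_eq, zero_sub, norm_neg, errorConst, hh]
  have e1 : 1 / muP A b c ^ 2 * (‖ss‖ / ‖c‖) = ‖ss‖ / (muP A b c * ‖c‖) / muP A b c := by
    field_simp
  have e2 : 1 / muD A c q ^ 2 * (‖xs‖ / ‖q‖) = ‖xs‖ / (muD A c q * ‖q‖) / muD A c q := by
    field_simp
  rw [e1, e2]
  have hk1 := U.one_le_p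
  have hk2 := U.one_le_d
  have h2 : ‖c - ss‖ / (muP A b c * ‖c‖) ≤ ‖ss‖ / (muP A b c * ‖c‖) := by
    gcongr; exact U.norm_sub_le
  -- The optimized weight makes the two summands of the first factor equal, which removes the mixed
  -- products of `1 / μ_p` and `1 / μ_d`.
  have hprod : (p / (muP A b c * ‖c‖) + 1 / (p * (muD A c q * ‖q‖))) * optRadius c xs ss p =
      2 * (‖xs‖ / (muD A c q * ‖q‖) + ‖c - ss‖ / (muP A b c * ‖c‖)) := by
    have hc' : muP A b c * ‖c‖ = p ^ 2 * (muD A c q * ‖q‖) := by rw [hp]; field_simp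
    rw [optRadius, hc']
    field_simp
    ring
  rw [mul_assoc 3, hprod]
  set α := ‖ss‖ / (muP A b c * ‖c‖) with hα
  set α' := ‖xs‖ / (muD A c q * ‖q‖) with hα'
  have g1 : α ≤ α / muP A b c := le_div_self (by linarith) hμp U.muP_le_one
  have g2 : α' ≤ α' / muD A c q := le_div_self (by linarith) hμd U.muD_le_one
  set K := α / muP A b c + α' / muD A c q with hK
  have hK0 : 0 ≤ K := by linarith
  calc 2 * kappa A * (1 + α + α' + 3 * (2 * (α' + ‖c - ss‖ / (muP A b c * ‖c‖))))
      ≤ 2 * kappa A * (8 * K) := by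
        refine mul_le_mul_of_nonneg_left ?_ (by positivity)
        linarith
    _ = 16 * kappa A * (1 * K) := by ring
    _ ≤ 16 * kappa A * ((√n + 1) * K) := by
        gcongr; linarith [U.two_le_sqrt_add_one]
    _ = _ := by ring

end Assembly

end RPDHG

theorem mainTheorem3 {m n : ℕ} (A : Matrix (Fin m) (Fin n) ℝ) (b : RPDHG.E m) (c q : RPDHG.E n)
    (hq : RPDHG.IsLeastNorm A b q)
    (hA : RPDHG.StandingAssumption A b c q)
    (hX : ∃! x, x ∈ RPDHG.Xopt A b c)
    (hS : ∃! s, s ∈ RPDHG.Sopt A c q) :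
    0 < RPDHG.muP A b c ∧ 0 < RPDHG.muD A c q ∧
    -- the new constants dominate the ones that involve the Limiting Error Ratios
    RPDHG.standardL A b c q ≤ RPDHG.standardL' A b c q ∧
    RPDHG.optimizedL A b c q ≤ RPDHG.optimizedL' A b c q ∧
    -- the complexity bound for the standard step-sizes, with the new constant
    (∀ ε : ℝ, 0 < ε → ε ≤ RPDHG.errD A b c q 0 c →
      ∃ T : ℕ,
        RPDHG.IsIterationCount A b c q
          (‖q‖ / (2 * RPDHG.kappa A * ‖c‖))
          (‖c‖ / (2 * ‖q‖ * RPDHG.lamMax A * RPDHG.lamMin A))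
          (1 / Real.exp 1) ε T ∧
        (T : ℝ) ≤ RPDHG.iterationBound (RPDHG.standardL' A b c q) (RPDHG.kappa A)
          (‖c‖ / ‖q‖) (RPDHG.errD A b c q 0 c) ε) ∧
    -- the complexity bound for the optimized step-sizes, with the new constant
    (∀ ε : ℝ, 0 < ε → ε ≤ RPDHG.errD A b c q 0 c →
      ∃ T : ℕ,
        RPDHG.IsIterationCount A b c q
          (RPDHG.muD A c q * ‖q‖ / (2 * RPDHG.kappa A * RPDHG.muP A b c * ‖c‖))
          (RPDHG.muP A b c * ‖c‖ /
            (2 * RPDHG.muD A c q * ‖q‖ * RPDHG.lamMax A * RPDHG.lamMin A))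
          (1 / Real.exp 1) ε T ∧
        (T : ℝ) ≤ RPDHG.iterationBound (RPDHG.optimizedL' A b c q) (RPDHG.kappa A)
          (RPDHG.muP A b c * ‖c‖ / (RPDHG.muD A c q * ‖q‖)) (RPDHG.errD A b c q 0 c) ε) := by
  obtain ⟨xs, hxs, hxu⟩ := hX
  obtain ⟨ss, hss, hsu⟩ := hS
  obtain ⟨-, hc, hnp, hnd⟩ := hA
  have U : RPDHG.UniqueOptima A b c q xs ss :=
    ⟨hc, RPDHG.ne_zero_of_nonempty_diff_optimal hnp, hq.mem_orthogonal,
      RPDHG.ne_zero_of_nonempty_diff_optimal hnd, hq.1, hxs, hxu, hss, hsu, hnp, hnd⟩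
  obtain ⟨ys, D⟩ := U.exists_sharpPair
  have hμp := U.muP_pos
  have hμd := U.muD_pos
  have hcn := norm_pos_iff.2 U.c_ne
  have hqn := norm_pos_iff.2 U.q_ne
  have hl := RPDHG.lamMin_pos A U.app_ne
  have hL := hl.trans_le (RPDHG.lamMin_le_lamMax A U.app_ne)
  have hκ : 0 < RPDHG.kappa A := div_pos hL hl
  have hh : √(2 * RPDHG.kappa A) ^ 2 = 2 * RPDHG.kappa A := Real.sq_sqrt (by positivity)
  refine ⟨hμp, hμd, U.standardL_le, U.optimizedL_le, fun ε hε hεE => ?_, fun ε hε hεE => ?_⟩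
  -- Both step-size choices have the form `τ = 1 / (2 κ ω)`, `σ = ω / (2 λ_max λ_min)`; only the
  -- ratio `ω` differs.
  · have hω : 0 < ‖c‖ / ‖q‖ := by positivity
    have hp : √(‖c‖ / ‖q‖) ^ 2 = ‖c‖ / ‖q‖ := Real.sq_sqrt hω.le
    obtain ⟨hst, hw⟩ := RPDHG.isStepSize_isWeight (A := A) U.app_ne hω
      (τ := ‖q‖ / (2 * RPDHG.kappa A * ‖c‖))
      (σ := ‖c‖ / (2 * ‖q‖ * RPDHG.lamMax A * RPDHG.lamMin A))
      (by field_simp) (by field_simp)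
    have h := D.exists_isIterationCount hst hw U.Xopt_eq U.Sopt_eq
      (U.errorConst_le_standardL' hh hw.p_pos hp) hε hεE
    rwa [hp] at h
  · have hω : 0 < RPDHG.muP A b c * ‖c‖ / (RPDHG.muD A c q * ‖q‖) := by positivity
    have hp := Real.sq_sqrt hω.le
    obtain ⟨hst, hw⟩ := RPDHG.isStepSize_isWeight (A := A) U.app_ne hω
      (τ := RPDHG.muD A c q * ‖q‖ / (2 * RPDHG.kappa A * RPDHG.muP A b c * ‖c‖))
      (σ := RPDHG.muP A b c * ‖c‖ /
        (2 * RPDHG.muD A c q * ‖q‖ * RPDHG.lamMax A * RPDHG.lamMin A))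
      (by field_simp) (by field_simp)
    have h := D.exists_isIterationCount hst hw U.Xopt_eq U.Sopt_eq
      (U.errorConst_le_optimizedL' hh hw.p_pos hp) hε hεE
    rwa [hp] at h
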